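/- **Setting.** Let $T>0$, $\delta\in[0,1]$, $\eta\in C^1([0,T];(0,\infty))$, $\kappa\in C^1([0,T];[0,\infty))$ and $\lambda\in L^\infty([0,T])$ with $\lambda\ge 0$ and $\lambda+\delta\dot\kappa\ge 0$ a.e. Let $\nu_0$ be a probability measure on $\mathbb R$ with finite first absolute moment; write $\mathbb E[\nu_0]=\int x\,\nu_0(dx)$, $q_0(x)=\nu_0([x,\infty))$ and $p_0(x)=\nu_0((-\infty,x])$. Let $A^\delta$ be the solution on $[0,T)$ of $$-\dot A_t=-\frac{A_t^2}{\eta_t}+\delta\frac{\kappa_t}{\eta_t}A_t+\lambda_t,\qquad \lim_{t\nearrow T}A_t=\infty ,$$ (in the sense of locally absolutely continuous functions satisfying the equation a.e.), and put, for $t\in[0,T)$, $$h^\delta_t=e^{-\int_0^t\frac{A^\delta_r}{\eta_r}dr}\int_0^t\frac1{\eta_s}e^{\int_0^s\frac{2A^\delta_r-\delta\kappa_r}{\eta_r}dr}\,ds,\qquad \alpha^\delta_T=\Big(\lim_{t\nearrow T}h^\delta_t\Big)^{-1},\qquad f_\mu(t)=\int_0^t\kappa_s h^\delta_s\mu_s\,ds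 .$$ These data are well defined: $A^\delta$ exists and is unique, the limit $\lim_{t\nearrow T}h^\delta_t$ exists, and $\alpha^\delta_T\in(0,\infty)$. For $c\in\mathbb R$ put $$\mu^c_T:=\frac{\alpha^\delta_T}{\eta_T}\Big(\mathbb E[\nu_0]-(1-q_0(0))\,c-\int_0^c q_0(x)\,dx\Big).$$ Consider the backward integral equation with exogenous terminal value, for $t\in[0,T]$, $$\mu_t=\mu^c_T+\int_t^T\frac{\kappa_s}{\eta_s}\Big(q_0\Big(c-\int_s^T\kappa_rh^\delta_r\mu_r\,dr\Big)+p_0(0)\Big)\mu_s\,ds+\int_t^T\frac{\lambda_s+\delta\dot\kappa_s}{\eta_s}\Big(\int_s^T\mu_u\,du\Big)ds+\int_t^T\frac{\dot\eta_s-\delta\kappa_s}{\eta_s}\mu_s\,ds \tag{1}$$ and the integral equation with endogenous terminal condition, for $t\in[0,T]$, $$\mu_t=\mu_T+\int_t^T\frac{\kappa_s}{\eta_s}\big(q_0(f_\mu(s))+p_0(0)\big)\mu_s\,ds+\int_t^T\frac{\lambda_s+\delta\dot\kappa_s}{\eta_s}\Big(\int_s^T\mu_u\,du\Big)ds+\int_t^T\frac{\dot\eta_s-\delta\kappa_s}{\eta_s}\mu_s\,ds,$$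 $$\mu_T=\frac{\alpha^\delta_T}{\eta_T}\Big(\mathbb E[\nu_0]-(1-q_0(0))\,x_\mu-\int_0^{x_\mu}q_0(x)\,dx\Big),\qquad x_\mu:=f_\mu(T). \tag{2}$$ **Theorem.** (i) For every $c\in\mathbb R$, equation (1) has a unique solution $\mu^c$ in $C^0([0,T])$. (ii) Suppose $\mathbb E[\nu_0]>0$. There is a unique $\hat x\in\mathbb R$ with $f_{\mu^{\hat x}}(T)=\hat x$. Moreover, $\mu^{\hat x}$ is the unique integrable function on $[0,T]$ that solves (2). It holds that $\hat x<\sup(\operatorname{supp}\nu_0)\in(-\infty,\infty]$ and, if $\kappa$ does not vanish identically on $[0,T]$, also $\hat x>0$. -/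

import Mathlib

open MeasureTheory Set Filter Topology

namespace LiquidationGame

noncomputable section

/-- `A` solves the singular terminal value problem
`-A' = -A² / η + δ (κ / η) A + lam` on `[0, T)`, `A(t) → ∞` as `t ↑ T`.
As `lam` is only essentially bounded, a solution is a continuous function that satisfies the
integrated equation (equivalently: a locally absolutely continuous function that satisfies the
differential equation almost everywhere). -/
def IsRiccatiSolution (T δ : ℝ) (η κ lam : ℝ → ℝ) (A : ℝ → ℝ) : Prop :=
  ContinuousOn A (Ico 0 T) ∧
  (∀ t ∈ Ico 0 T,
    A t = A 0 + ∫ s in (0 : ℝ)..t, ((A s) ^ 2 / η s - δ * (κ s / η s) * A s - lam s)) ∧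
  Tendsto A (𝓝[<] T) atTop

/-- The solution `A^δ` of the singular terminal value problem (only its values on `[0, T)`
matter). -/
def riccati (T δ : ℝ) (η κ lam : ℝ → ℝ) : ℝ → ℝ :=
  Classical.epsilon (IsRiccatiSolution T δ η κ lam)

/-- `h^δ_t = exp (-∫₀ᵗ A/η) ∫₀ᵗ (1/η_s) exp (∫₀ˢ (2A - δκ)/η) ds` for `t ∈ [0, T)`. Below, `h^δ` is
only used under integrals over subintervals of `[0, T]` and through its limit at `T`, so the value
at `t = T` plays no role. -/
def hFun (T δ : ℝ) (η κ lam : ℝ → ℝ) (t : ℝ) : ℝ :=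
  Real.exp (-∫ r in (0 : ℝ)..t, riccati T δ η κ lam r / η r) *
    ∫ s in (0 : ℝ)..t, 1 / η s *
      Real.exp (∫ r in (0 : ℝ)..s, (2 * riccati T δ η κ lam r - δ * κ r) / η r)

/-- `α^δ_T = (lim_{t ↑ T} h^δ_t)⁻¹`. -/
def alphaT (T δ : ℝ) (η κ lam : ℝ → ℝ) : ℝ :=
  (limUnder (𝓝[<] T) (hFun T δ η κ lam))⁻¹

/-- `f_μ(t) = ∫₀ᵗ κ_s h^δ_s μ_s ds`. -/
def fFun (T δ : ℝ) (η κ lam : ℝ → ℝ) (μ : ℝ → ℝ) (t : ℝ) : ℝ :=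
  ∫ s in (0 : ℝ)..t, κ s * hFun T δ η κ lam s * μ s

/-- The left tail `p₀(x) = ν₀((-∞, x])`. -/
def pTail (ν₀ : Measure ℝ) (x : ℝ) : ℝ := ν₀.real (Iic x)

/-- The right tail `q₀(x) = ν₀([x, ∞))`. -/
def qTail (ν₀ : Measure ℝ) (x : ℝ) : ℝ := ν₀.real (Ici x)

/-- The terminal value
`μ^c_T = (α^δ_T / η_T) (E[ν₀] - (1 - q₀(0)) c - ∫₀ᶜ q₀(x) dx)`. -/
def terminalValue (T δ : ℝ) (η κ lam : ℝ → ℝ) (ν₀ : Measure ℝ) (c : ℝ) : ℝ :=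
  alphaT T δ η κ lam / η T *
    ((∫ x, x ∂ν₀) - (1 - qTail ν₀ 0) * c - ∫ x in (0 : ℝ)..c, qTail ν₀ x)

/-- `μ` is a continuous solution on `[0, T]` of the backward integral equation with parameter `c`
and exogenous terminal value `μ^c_T`. -/
def IsBackwardSolution (T δ : ℝ) (η κ lam : ℝ → ℝ) (ν₀ : Measure ℝ) (c : ℝ) (μ : ℝ → ℝ) : Prop :=
  ContinuousOn μ (Icc 0 T) ∧
  ∀ t ∈ Icc 0 T,
    μ t = terminalValue T δ η κ lam ν₀ c
      + (∫ s in t..T, κ s / η s *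
          (qTail ν₀ (c - ∫ r in s..T, κ r * hFun T δ η κ lam r * μ r) + pTail ν₀ 0) * μ s)
      + (∫ s in t..T, (lam s + δ * derivWithin κ (Icc 0 T) s) / η s * ∫ u in s..T, μ u)
      + ∫ s in t..T, (derivWithin η (Icc 0 T) s - δ * κ s) / η s * μ s

/-- `μ ∈ L¹([0, T])` solves the equilibrium integral equation together with its endogenous terminal
condition, in which `c = f_μ(T)`. -/
def IsEquilibriumSolution (T δ : ℝ) (η κ lam : ℝ → ℝ) (ν₀ : Measure ℝ) (μ : ℝ → ℝ) : Prop :=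
  IntegrableOn μ (Icc 0 T) ∧
  (∀ t ∈ Icc 0 T,
    μ t = μ T
      + (∫ s in t..T, κ s / η s *
          (qTail ν₀ (fFun T δ η κ lam μ s) + pTail ν₀ 0) * μ s)
      + (∫ s in t..T, (lam s + δ * derivWithin κ (Icc 0 T) s) / η s * ∫ u in s..T, μ u)
      + ∫ s in t..T, (derivWithin η (Icc 0 T) s - δ * κ s) / η s * μ s) ∧
  μ T = terminalValue T δ η κ lam ν₀ (fFun T δ η κ lam μ T)

end

end LiquidationGame

/-! The difficulty is that `q₀` may jump, so the feedback term is not Lipschitz in the unknown path.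
A conserved quantity removes it. Let `M_t = ∫ₜᵀ μ`, `g_t = c - ∫ₜᵀ κ h μ`, and let `ρ = q₀ + p₀(0)`.
The function `h` of the statement, together with `w = η h'`, solves the linear system behind the
Riccati equation, and along every solution of (1) the expression `h (η μ + δ κ M) + w M + ∫₀^g ρ` is
constant (`IsTrajectory.conservation`). Solved for `μ`, this identity contains only the primitive of
`ρ`, which is Lipschitz. Hence `(M, g)` solves an ordinary differential equation that is Lipschitz
on `[a, T]` for each `a > 0`, which yields existence, uniqueness and stability there. The
coefficients blow up at `0` because `h` vanishes; a bound independent of `a`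
(`IsTrajectory.exists_growth`) and the integral equation itself carry the solution to `0`.

For (ii), the fixed-point condition `f_μ(T) = c` says exactly that `g_0 = 0`. Linear backward
Volterra equations with nonnegative memory preserve signs (`nonneg_of_backward_volterra`), and `ρ`
is decreasing; so when `c` grows and the terminal value stays nonnegative at the smaller parameter,
`g_0` grows at least as fast as `c` (`IsTrajectory.sub_le_sub`). This gives uniqueness, while
continuity in `c` and the intermediate value theorem give existence. At the root the terminal value
is positive, so `μ > 0`, whence `x̂ > 0` if `κ` is not identically zero. The upper bound on `x̂`
follows because the terminal value cannot be positive at a `c ≥ 0` beyond which `ν₀` has no mass.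

The Riccati data are made explicit by a fundamental system `(h, w)`, `(u, v)` of the linear system:
`A = -v / u`, and `α_T = 1 / h(T)`. -/

namespace LiquidationGame

/-! ### Calculus of absolutely continuous functions with prescribed almost everywhere derivative. -/

/-- `f` is absolutely continuous on `[a, b]` with almost everywhere derivative `f'`. -/
structure HasACDerivOn (f f' : ℝ → ℝ) (a b : ℝ) : Prop where
  le : a ≤ b
  ac : AbsolutelyContinuousOnInterval f a b
  ae_hasDerivAt : ∀ᵐ x, x ∈ Ioo a b → HasDerivAt f (f' x) x

namespace HasACDerivOn

variable {f f' g g' : ℝ → ℝ} {a b : ℝ}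

theorem continuousOn (hf : HasACDerivOn f f' a b) : ContinuousOn f (Icc a b) := by
  have := hf.ac.continuousOn
  rwa [uIcc_of_le hf.le] at this

theorem ae_deriv_eq (hf : HasACDerivOn f f' a b) :
    ∀ᵐ x, x ∈ uIoc a b → deriv f x = f' x := by
  have hb : ∀ᵐ x : ℝ, x ≠ b := by simp [ae_iff, measure_singleton]
  filter_upwards [hf.ae_hasDerivAt, hb] with x hx hxb hxm
  rw [uIoc_of_le hf.le] at hxm
  exact (hx ⟨hxm.1, lt_of_le_of_ne hxm.2 hxb⟩).deriv

theorem intervalIntegrable (hf : HasACDerivOn f f' a b) : IntervalIntegrable f' volume a b := by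
  refine hf.ac.intervalIntegrable_deriv.congr_ae ?_
  exact (ae_restrict_iff' measurableSet_uIoc).2 hf.ae_deriv_eq

theorem mono {c d : ℝ} (hf : HasACDerivOn f f' a b) (hac : a ≤ c) (hcd : c ≤ d) (hdb : d ≤ b) :
    HasACDerivOn f f' c d where
  le := hcd
  ac := hf.ac.mono (by rw [uIcc_of_le hcd, uIcc_of_le hf.le]; exact Icc_subset_Icc hac hdb)
  ae_hasDerivAt := by
    filter_upwards [hf.ae_hasDerivAt] with x hx hxm
    exact hx ⟨hac.trans_lt hxm.1, hxm.2.trans_le hdb⟩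

theorem integral_eq_sub (hf : HasACDerivOn f f' a b) {s t : ℝ} (hs : a ≤ s) (hst : s ≤ t)
    (ht : t ≤ b) : ∫ x in s..t, f' x = f t - f s := by
  have h := hf.mono hs hst ht
  rw [← h.ac.integral_deriv_eq_sub]
  refine intervalIntegral.integral_congr_ae ?_
  filter_upwards [h.ae_deriv_eq] with x hx hxm using (hx hxm).symm

theorem congr (hf : HasACDerivOn f f' a b) (h : EqOn g f (Icc a b)) : HasACDerivOn g f' a b where
  le := hf.le
  ac := by
    have := hf.ac
    rw [absolutelyContinuousOnInterval_iff] at this ⊢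
    intro ε hε
    obtain ⟨δ, hδ, H⟩ := this ε hε
    refine ⟨δ, hδ, fun E hE hs => ?_⟩
    have hH := H E hE hs
    convert hH using 1
    refine Finset.sum_congr rfl fun i hi => ?_
    have := (hE.1 i hi)
    rw [uIcc_of_le hf.le] at this
    rw [h this.1, h this.2]
  ae_hasDerivAt := by
    filter_upwards [hf.ae_hasDerivAt] with x hx hxm
    refine (hx hxm).congr_of_eventuallyEq ?_
    filter_upwards [Icc_mem_nhds hxm.1 hxm.2] with y hy using h hy

theorem congr_deriv (hf : HasACDerivOn f f' a b) (h : ∀ᵐ x, x ∈ Ioo a b → g' x = f' x) :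
    HasACDerivOn f g' a b where
  le := hf.le
  ac := hf.ac
  ae_hasDerivAt := by
    filter_upwards [hf.ae_hasDerivAt, h] with x hx hx' hxm
    rw [hx' hxm]; exact hx hxm

theorem of_integral {c : ℝ} (hab : a ≤ b) (hc : c ∈ Icc a b)
    (hf' : IntervalIntegrable f' volume a b)
    (h : ∀ t ∈ Icc a b, f t = f c + ∫ x in c..t, f' x) : HasACDerivOn f f' a b := by
  rw [← uIcc_of_le hab] at hc
  have h1 : HasACDerivOn (fun t => f c + ∫ x in c..t, f' x) f' a b :=
    { le := hab
      ac := by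
        have h0 : AbsolutelyContinuousOnInterval (fun _ : ℝ => f c) a b :=
          (LipschitzWith.const (f c)).lipschitzOnWith.absolutelyContinuousOnInterval
        exact h0.add (hf'.absolutelyContinuousOnInterval_intervalIntegral hc)
      ae_hasDerivAt := by
        filter_upwards [hf'.ae_hasDerivAt_integral] with x hx hxm
        exact (hx (by rw [uIcc_of_le hab]; exact Ioo_subset_Icc_self hxm) c hc).const_add (f c) }
  exact h1.congr h

theorem of_contDiffOn (hab : a < b) (hf : ContDiffOn ℝ 1 f (Icc a b)) :
    HasACDerivOn f (derivWithin f (Icc a b)) a b where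
  le := hab.le
  ac := by
    rw [← uIcc_of_le hab.le] at hf
    exact hf.absolutelyContinuousOnInterval
  ae_hasDerivAt := by
    filter_upwards with x hx
    have h1 : DifferentiableWithinAt ℝ f (Icc a b) x :=
      (hf.differentiableOn (by norm_num)) x (Ioo_subset_Icc_self hx)
    exact h1.hasDerivWithinAt.hasDerivAt (Icc_mem_nhds hx.1 hx.2)

theorem const (hab : a ≤ b) (c : ℝ) : HasACDerivOn (fun _ => c) (fun _ => 0) a b where
  le := hab
  ac := (LipschitzWith.const c).lipschitzOnWith.absolutelyContinuousOnInterval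
  ae_hasDerivAt := by
    filter_upwards with x _ using hasDerivAt_const x c

theorem add (hf : HasACDerivOn f f' a b) (hg : HasACDerivOn g g' a b) :
    HasACDerivOn (fun x => f x + g x) (fun x => f' x + g' x) a b where
  le := hf.le
  ac := hf.ac.add hg.ac
  ae_hasDerivAt := by
    filter_upwards [hf.ae_hasDerivAt, hg.ae_hasDerivAt] with x h1 h2 hx
    exact (h1 hx).add (h2 hx)

theorem neg (hf : HasACDerivOn f f' a b) :
    HasACDerivOn (fun x => -f x) (fun x => -f' x) a b where
  le := hf.le
  ac := hf.ac.neg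
  ae_hasDerivAt := by
    filter_upwards [hf.ae_hasDerivAt] with x h1 hx
    exact (h1 hx).neg

theorem sub (hf : HasACDerivOn f f' a b) (hg : HasACDerivOn g g' a b) :
    HasACDerivOn (fun x => f x - g x) (fun x => f' x - g' x) a b := by
  simpa only [sub_eq_add_neg] using hf.add hg.neg

theorem mul (hf : HasACDerivOn f f' a b) (hg : HasACDerivOn g g' a b) :
    HasACDerivOn (fun x => f x * g x) (fun x => f' x * g x + f x * g' x) a b where
  le := hf.le
  ac := hf.ac.mul hg.ac
  ae_hasDerivAt := by
    filter_upwards [hf.ae_hasDerivAt, hg.ae_hasDerivAt] with x h1 h2 hx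
    exact (h1 hx).mul (h2 hx)

theorem const_mul (c : ℝ) (hf : HasACDerivOn f f' a b) :
    HasACDerivOn (fun x => c * f x) (fun x => c * f' x) a b where
  le := hf.le
  ac := hf.ac.const_mul c
  ae_hasDerivAt := by
    filter_upwards [hf.ae_hasDerivAt] with x h1 hx
    exact (h1 hx).const_mul c

theorem _root_.LiquidationGame.absolutelyContinuousOnInterval_comp {φ : ℝ → ℝ} {K : NNReal}
    {s : Set ℝ} (hφ : LipschitzOnWith K φ s) (hf : AbsolutelyContinuousOnInterval f a b)
    (hs : ∀ x ∈ uIcc a b, f x ∈ s) : AbsolutelyContinuousOnInterval (fun x => φ (f x)) a b := by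
  rw [absolutelyContinuousOnInterval_iff] at hf ⊢
  intro ε hε
  -- Dividing by `K + 1` rather than `K` covers `K = 0` and makes the final inequality strict.
  obtain ⟨δ, hδ, H⟩ := hf (ε / (K + 1)) (by positivity)
  refine ⟨δ, hδ, fun E hE hsum => ?_⟩
  have hH := H E hE hsum
  calc ∑ i ∈ Finset.range E.1, dist (φ (f (E.2 i).1)) (φ (f (E.2 i).2))
      ≤ ∑ i ∈ Finset.range E.1, K * dist (f (E.2 i).1) (f (E.2 i).2) := by
        refine Finset.sum_le_sum fun i hi => ?_
        exact hφ.dist_le_mul _ (hs _ (hE.1 i hi).1) _ (hs _ (hE.1 i hi).2)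
    _ = K * ∑ i ∈ Finset.range E.1, dist (f (E.2 i).1) (f (E.2 i).2) := by rw [Finset.mul_sum]
    _ ≤ K * (ε / (K + 1)) := by gcongr
    _ < ε := by
        rw [mul_div_assoc', div_lt_iff₀ (by positivity)]
        nlinarith

theorem comp {φ : ℝ → ℝ} (hf : HasACDerivOn f f' a b)
    (hφ : ∀ x ∈ Icc a b, ContDiffAt ℝ 1 φ (f x)) :
    HasACDerivOn (fun x => φ (f x)) (fun x => deriv φ (f x) * f' x) a b where
  le := hf.le
  ac := by
    have hcpt : IsCompact (f '' Icc a b) := isCompact_Icc.image_of_continuousOn hf.continuousOn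
    -- The image is a compact interval, and on a compact convex set a `C¹` function is Lipschitz.
    have hconv : Convex ℝ (f '' Icc a b) :=
      (isPreconnected_Icc.image _ hf.continuousOn).ordConnected.convex
    have hC : ContDiffOn ℝ 1 φ (f '' Icc a b) := by
      rintro _ ⟨x, hx, rfl⟩
      exact (hφ x hx).contDiffWithinAt
    obtain ⟨K, hK⟩ := hC.exists_lipschitzOnWith (by decide) hconv hcpt
    refine absolutelyContinuousOnInterval_comp hK hf.ac fun x hx => ?_
    rw [uIcc_of_le hf.le] at hx
    exact mem_image_of_mem f hx
  ae_hasDerivAt := by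
    filter_upwards [hf.ae_hasDerivAt] with x h1 hx
    exact ((hφ x (Ioo_subset_Icc_self hx)).differentiableAt (by norm_num)).hasDerivAt.comp x (h1 hx)

theorem inv (hf : HasACDerivOn f f' a b) (h0 : ∀ x ∈ Icc a b, f x ≠ 0) :
    HasACDerivOn (fun x => (f x)⁻¹) (fun x => -f' x / f x ^ 2) a b := by
  refine (hf.comp (φ := fun y => y⁻¹) fun x hx => contDiffAt_inv ℝ (h0 x hx)).congr_deriv ?_
  filter_upwards with x _
  rw [deriv_inv]; ring

theorem exp (hf : HasACDerivOn f f' a b) :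
    HasACDerivOn (fun x => Real.exp (f x)) (fun x => f' x * Real.exp (f x)) a b := by
  refine (hf.comp (φ := Real.exp) fun x _ => Real.contDiff_exp.contDiffAt).congr_deriv ?_
  filter_upwards with x _
  rw [Real.deriv_exp]; ring

/-- Absolute continuity is what turns an almost everywhere identity into constancy; the Wronskian
identity, Riccati uniqueness and the conserved quantity are all obtained this way. -/
theorem eq_of_ae_zero (hf : HasACDerivOn f f' a b) (h : ∀ᵐ x, x ∈ Ioo a b → f' x = 0)
    {s t : ℝ} (hs : s ∈ Icc a b) (ht : t ∈ Icc a b) : f s = f t := by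
  have key : ∀ t ∈ Icc a b, f t = f a := fun t ht => by
    have h0 : HasACDerivOn f (fun _ => 0) a b := hf.congr_deriv (by
      filter_upwards [h] with x hx hxm using (hx hxm).symm)
    have := h0.integral_eq_sub le_rfl ht.1 ht.2
    simp at this
    linarith
  rw [key s hs, key t ht]

theorem le_of_ae_nonneg (hf : HasACDerivOn f f' a b) (h : ∀ᵐ x, x ∈ Ioo a b → 0 ≤ f' x)
    {s t : ℝ} (hs : a ≤ s) (hst : s ≤ t) (ht : t ≤ b) : f s ≤ f t := by
  have h1 := hf.integral_eq_sub hs hst ht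
  have hb : ∀ᵐ x : ℝ, x ≠ t := by simp [ae_iff, measure_singleton]
  have h2 : 0 ≤ ∫ x in s..t, f' x := by
    refine intervalIntegral.integral_nonneg_of_ae_restrict hst ?_
    rw [← restrict_Ioo_eq_restrict_Icc, EventuallyLE, ae_restrict_iff' measurableSet_Ioo]
    filter_upwards [h] with x hx hxm
    exact hx ⟨hs.trans_lt hxm.1, hxm.2.trans_le ht⟩
  linarith

end HasACDerivOn

end LiquidationGame

/-! ### Primitives of monotone functions and a backward Grönwall inequality. -/

namespace LiquidationGame

theorem lipschitzWith_integral {q : ℝ → ℝ} (hq : Antitone q) {K : NNReal}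
    (hK : ∀ x, |q x| ≤ K) : LipschitzWith K fun x => ∫ y in (0 : ℝ)..x, q y := by
  refine LipschitzWith.of_dist_le_mul fun x y => ?_
  rw [Real.dist_eq, Real.dist_eq, intervalIntegral.integral_interval_sub_left
    hq.intervalIntegrable hq.intervalIntegrable]
  exact intervalIntegral.norm_integral_le_of_norm_le_const (C := K) fun z _ => by
    rw [Real.norm_eq_abs]; exact hK z

/-- A level set contains only countably many points with a nonzero derivative. -/
theorem countable_hasDerivAt_ne_zero_of_eq (f : ℝ → ℝ) (c : ℝ) :
    {x | f x = c ∧ ∃ d, d ≠ 0 ∧ HasDerivAt f d x}.Countable := by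
  set S := {x | f x = c ∧ ∃ d, d ≠ 0 ∧ HasDerivAt f d x} with hS
  -- A nonzero derivative makes the point isolated in its level set, and a discrete subset of the
  -- line is countable by the Lindelöf property.
  have hd : IsDiscrete S := by
    rw [isDiscrete_iff_nhdsNE]
    rintro x ⟨hx, d, hd0, hd⟩
    have := hd.eventually_ne (c := c) hd0
    rw [← disjoint_iff, disjoint_principal_right]
    filter_upwards [this] with y hy hyS using hy hyS.1
  have : DiscreteTopology S := hd.to_subtype
  exact (countable_of_Lindelof_of_discrete (X := S) : Countable S).to_set

/-- Chain rule for a primitive whose integrand may jump. Where `f' = 0`, the Lipschitz bound on the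
primitive forces derivative `0`, whatever `q` does. Where `f' ≠ 0`, the path can sit at one of the
countably many jumps of `q` only at countably many times. -/
theorem HasACDerivOn.integral_antitone_comp {f f' q : ℝ → ℝ} {a b : ℝ} {K : NNReal}
    (hf : HasACDerivOn f f' a b) (hq : Antitone q) (hK : ∀ x, |q x| ≤ K) :
    HasACDerivOn (fun t => ∫ x in (0 : ℝ)..f t, q x) (fun t => q (f t) * f' t) a b where
  le := hf.le
  ac := absolutelyContinuousOnInterval_comp (φ := fun x => ∫ y in (0 : ℝ)..x, q y)
    ((lipschitzWith_integral hq hK).lipschitzOnWith (s := univ)) hf.ac fun _ _ => mem_univ _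
  ae_hasDerivAt := by
    have hcount : {x | ¬ ContinuousAt q x}.Countable := hq.countable_not_continuousAt
    have hnull : ∀ᵐ x, x ∉ ⋃ c ∈ {x | ¬ ContinuousAt q x},
        {x | f x = c ∧ ∃ d, d ≠ 0 ∧ HasDerivAt f d x} :=
      (hcount.biUnion fun c _ => countable_hasDerivAt_ne_zero_of_eq f c).ae_notMem _
    filter_upwards [hf.ae_hasDerivAt, hnull] with x hx hx' hxm
    have hd := hx hxm
    by_cases h0 : f' x = 0
    · rw [h0, mul_zero]
      rw [h0] at hd
      rw [hasDerivAt_iff_isLittleO] at hd ⊢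
      simp only [smul_zero, sub_zero] at hd ⊢
      refine Asymptotics.IsBigO.trans_isLittleO ?_ hd
      refine Asymptotics.IsBigO.of_bound K (Eventually.of_forall fun y => ?_)
      exact (lipschitzWith_integral hq hK).dist_le_mul (f y) (f x)
    · have hc : ContinuousAt q (f x) := by
        by_contra hc
        exact hx' (mem_biUnion (x := f x) hc ⟨rfl, f' x, h0, hd⟩)
      have hQ : HasDerivAt (fun x => ∫ y in (0 : ℝ)..x, q y) (q (f x)) (f x) :=
        intervalIntegral.integral_hasDerivAt_right hq.intervalIntegrable
          (hq.measurable.stronglyMeasurable.stronglyMeasurableAtFilter) hc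
      exact hQ.comp x hd

theorem HasACDerivOn.integral_left {f : ℝ → ℝ} {a b : ℝ} (hab : a ≤ b)
    (hf : IntervalIntegrable f volume a b) :
    HasACDerivOn (fun t => ∫ x in t..b, f x) (fun t => -f t) a b := by
  refine HasACDerivOn.of_integral (c := b) hab (right_mem_Icc.2 hab) hf.neg fun t _ => ?_
  simp only [intervalIntegral.integral_same, zero_add, intervalIntegral.integral_neg]
  exact intervalIntegral.integral_symm _ _

theorem HasACDerivOn.integral_right {f : ℝ → ℝ} {a b : ℝ} (hab : a ≤ b)
    (hf : IntervalIntegrable f volume a b) :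
    HasACDerivOn (fun t => ∫ x in a..t, f x) f a b := by
  refine HasACDerivOn.of_integral (c := a) hab (left_mem_Icc.2 hab) hf fun t _ => ?_
  simp

theorem HasACDerivOn.const_mul_id {a b : ℝ} (hab : a ≤ b) (K : ℝ) :
    HasACDerivOn (fun t => K * t) (fun _ => K) a b := by
  refine ⟨hab, ?_, ?_⟩
  · refine ContDiffOn.absolutelyContinuousOnInterval ?_
    exact (contDiff_const.mul contDiff_id).contDiffOn
  · filter_upwards with x _
    simpa using (hasDerivAt_id x).const_mul K

/-- Grönwall's inequality in integral form, backward in time. -/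
theorem le_mul_exp_of_le_integral {f : ℝ → ℝ} {a b C K : ℝ} (hab : a ≤ b) (hK : 0 ≤ K)
    (hf : ContinuousOn f (Icc a b)) (h : ∀ t ∈ Icc a b, f t ≤ C + K * ∫ s in t..b, f s)
    {t : ℝ} (ht : t ∈ Icc a b) : f t ≤ C * Real.exp (K * (b - t)) := by
  have hint : IntervalIntegrable f volume a b := by
    rw [← uIcc_of_le hab] at hf
    exact hf.intervalIntegrable
  have h1 := ((HasACDerivOn.const hab C).add ((HasACDerivOn.integral_left hab hint).const_mul K))
  -- The majorant `C + K ∫ₜᵇ f` times `exp (K t)` is nondecreasing, by the hypothesis on `f`.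
  have h2 := h1.mul (HasACDerivOn.const_mul_id hab K).exp
  have h3 := h2.le_of_ae_nonneg (by
    filter_upwards with x hx
    have := h x (Ioo_subset_Icc_self hx)
    have h4 : 0 ≤ K * ((C + K * ∫ s in x..b, f s) - f x) * Real.exp (K * x) := by
      have := sub_nonneg.2 this
      positivity
    nlinarith) ht.1 ht.2 le_rfl
  simp only [intervalIntegral.integral_same, mul_zero, add_zero] at h3
  have h5 : (C + K * ∫ s in t..b, f s) ≤ C * Real.exp (K * (b - t)) := by
    have : Real.exp (K * (b - t)) = Real.exp (K * b) / Real.exp (K * t) := by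
      rw [← Real.exp_sub]; ring_nf
    rw [this, mul_div_assoc', le_div_iff₀ (Real.exp_pos _)]
    exact h3
  exact (h t ht).trans h5

/-! ### Picard iteration for vector fields that are only measurable in time. -/

section IntegralEquation

variable {E : Type*} [NormedAddCommGroup E] [NormedSpace ℝ E]

/-- The Picard operator on continuous curves, for a vector field that is merely measurable in
time. -/
noncomputable def picardMap {a b : ℝ} (hab : a ≤ b) (t₀ : Icc a b) (F : ℝ → E → E)
    (hF : ∀ x : ℝ → E, Continuous x → IntervalIntegrable (fun s => F s (x s)) volume a b)
    (x₀ : E) (α : C(Icc a b, E)) : C(Icc a b, E) where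
  toFun t := x₀ + ∫ s in t₀.1..t.1, F s (IccExtend hab α s)
  continuous_toFun := by
    have hint := hF _ (α.continuous.Icc_extend' (h := hab))
    have h1 : ContinuousOn (fun t => ∫ s in t₀.1..t, F s (IccExtend hab α s)) (uIcc a b) :=
      intervalIntegral.continuousOn_primitive_interval' hint (by
        rw [uIcc_of_le hab]; exact t₀.2)
    rw [uIcc_of_le hab] at h1
    exact continuous_const.add (continuousOn_iff_continuous_domRestrict.1 h1)

/-- The Lipschitz condition is needed only for almost every time, since it enters under an integral.
Iterated integration produces the factorial. -/
theorem dist_iterate_picardMap_le {a b : ℝ} (hab : a ≤ b) (t₀ : Icc a b) (F : ℝ → E → E)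
    (hF : ∀ x : ℝ → E, Continuous x → IntervalIntegrable (fun s => F s (x s)) volume a b)
    {K : ℝ} (hK : 0 ≤ K)
    (hlip : ∀ᵐ s, s ∈ Icc a b → ∀ x y, ‖F s x - F s y‖ ≤ K * ‖x - y‖) (x₀ : E)
    (α β : C(Icc a b, E)) (n : ℕ) (t : Icc a b) :
    dist ((picardMap hab t₀ F hF x₀)^[n] α t) ((picardMap hab t₀ F hF x₀)^[n] β t) ≤
      (K * |t.1 - t₀.1|) ^ n / n.factorial * dist α β := by
  induction n generalizing t with
  | zero => simpa using ContinuousMap.dist_apply_le_dist (f := α) (g := β) t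
  | succ n hn =>
    have hsub : uIcc t₀.1 t.1 ⊆ uIcc a b := by
      rw [uIcc_of_le hab]; exact uIcc_subset_Icc t₀.2 t.2
    have hi (γ : C(Icc a b, E)) :
        IntervalIntegrable (fun s => F s (IccExtend hab γ s)) volume t₀.1 t.1 :=
      (hF _ (γ.continuous.Icc_extend' (h := hab))).mono_set hsub
    rw [Function.iterate_succ_apply', Function.iterate_succ_apply', dist_eq_norm]
    set α' := (picardMap hab t₀ F hF x₀)^[n] α
    set β' := (picardMap hab t₀ F hF x₀)^[n] β
    change ‖(x₀ + ∫ s in t₀.1..t.1, F s (IccExtend hab α' s)) -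
      (x₀ + ∫ s in t₀.1..t.1, F s (IccExtend hab β' s))‖ ≤ _
    rw [add_sub_add_left_eq_sub, ← intervalIntegral.integral_sub (hi α') (hi β')]
    calc
      _ ≤ ∫ τ in uIoc t₀.1 t.1, K ^ (n + 1) * |τ - t₀| ^ n / n.factorial * dist α β := by
        rw [intervalIntegral.norm_intervalIntegral_eq]
        apply MeasureTheory.norm_integral_le_of_norm_le (Continuous.integrableOn_uIoc (by fun_prop))
        filter_upwards [ae_restrict_mem measurableSet_Ioc, ae_restrict_of_ae hlip] with s hs hl
        have hs' : s ∈ Icc a b := by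
          rw [← uIcc_of_le hab]; exact hsub (uIoc_subset_uIcc hs)
        refine (hl hs' _ _).trans ?_
        rw [IccExtend_of_mem _ _ hs', IccExtend_of_mem _ _ hs', ← dist_eq_norm]
        calc K * dist (α' ⟨s, hs'⟩) (β' ⟨s, hs'⟩)
            ≤ K * ((K * |s - t₀.1|) ^ n / n.factorial * dist α β) := by
              gcongr; exact hn ⟨s, hs'⟩
          _ = _ := by rw [mul_pow]; ring
      _ ≤ (K * |t.1 - t₀.1|) ^ (n + 1) / (n + 1).factorial * dist α β := by
        apply le_of_abs_le
        rw [← intervalIntegral.abs_intervalIntegral_eq, intervalIntegral.integral_mul_const,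
          intervalIntegral.integral_div, intervalIntegral.integral_const_mul, abs_mul, abs_div,
          abs_mul, intervalIntegral.abs_intervalIntegral_eq, integral_pow_abs_sub_uIoc, abs_div,
          abs_pow, abs_pow, abs_dist, abs_of_nonneg hK, abs_abs, mul_div, div_div, ← abs_mul,
          ← Nat.cast_succ, ← Nat.cast_mul, ← Nat.factorial_succ, Nat.abs_cast, ← mul_pow]

theorem exists_integral_solution [CompleteSpace E] {a b t₀ : ℝ} (hab : a ≤ b)
    (ht₀ : t₀ ∈ Icc a b) (F : ℝ → E → E)
    (hF : ∀ x : ℝ → E, Continuous x → IntervalIntegrable (fun s => F s (x s)) volume a b)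
    {K : ℝ} (hK : 0 ≤ K)
    (hlip : ∀ᵐ s, s ∈ Icc a b → ∀ x y, ‖F s x - F s y‖ ≤ K * ‖x - y‖) (x₀ : E) :
    ∃ x : ℝ → E, Continuous x ∧ ∀ t ∈ Icc a b, x t = x₀ + ∫ s in t₀..t, F s (x s) := by
  -- Some iterate contracts on the whole interval, so no subdivision is needed; the fixed point of
  -- that iterate is also fixed by the Picard map.
  obtain ⟨n, hn⟩ := FloorSemiring.tendsto_pow_div_factorial_atTop (K * (b - a))
    |>.eventually (gt_mem_nhds zero_lt_one) |>.exists
  have hpos : (0 : ℝ) ≤ (K * (b - a)) ^ n / n.factorial := by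
    have : 0 ≤ b - a := sub_nonneg.2 hab
    positivity
  set Φ := picardMap hab ⟨t₀, ht₀⟩ F hF x₀ with hΦ
  have hcontr : ContractingWith ⟨_, hpos⟩ Φ^[n] := by
    refine ⟨hn, LipschitzWith.of_dist_le_mul fun α β => ?_⟩
    rw [ContinuousMap.dist_le (by positivity)]
    intro t
    refine (dist_iterate_picardMap_le hab ⟨t₀, ht₀⟩ F hF hK hlip x₀ α β n t).trans ?_
    change _ ≤ (K * (b - a)) ^ n / n.factorial * dist α β
    gcongr
    rw [abs_le]
    constructor <;> linarith [t.2.1, t.2.2, ht₀.1, ht₀.2]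
  have hfix := hcontr.isFixedPt_fixedPoint_iterate
  set α := hcontr.fixedPoint Φ^[n]
  refine ⟨IccExtend hab α, α.continuous.Icc_extend' (h := hab), fun t ht => ?_⟩
  rw [IccExtend_of_mem _ _ ht]
  exact (DFunLike.congr_fun hfix ⟨t, ht⟩).symm

end IntegralEquation

end LiquidationGame

/-! ### The linear system behind the Riccati equation. -/

namespace LiquidationGame

/-- The standing assumptions on the coefficients. -/
structure IsMarket (T δ : ℝ) (η κ lam : ℝ → ℝ) : Prop where
  T_pos : 0 < T
  δ_mem : δ ∈ Icc (0 : ℝ) 1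
  contDiffOn_η : ContDiffOn ℝ 1 η (Icc 0 T)
  η_pos : ∀ t ∈ Icc 0 T, 0 < η t
  contDiffOn_κ : ContDiffOn ℝ 1 κ (Icc 0 T)
  κ_nonneg : ∀ t ∈ Icc 0 T, 0 ≤ κ t
  memLp_lam : MemLp lam ⊤ (volume.restrict (Icc 0 T))
  lam_nonneg : ∀ᵐ t ∂volume.restrict (Icc 0 T), 0 ≤ lam t
  lam_add_nonneg : ∀ᵐ t ∂volume.restrict (Icc 0 T), 0 ≤ lam t + δ * derivWithin κ (Icc 0 T) t

/-- `(u, w)` solves the linear system `u' = w / η`, `w' = -δ κ / η w + lam u` that linearizes the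
Riccati equation. -/
structure IsLinearSolution (T δ : ℝ) (η κ lam u w : ℝ → ℝ) : Prop where
  fst : HasACDerivOn u (fun t => w t / η t) 0 T
  snd : HasACDerivOn w (fun t => -(δ * (κ t / η t)) * w t + lam t * u t) 0 T

/-- The integrating factor `exp (∫₀ᵗ δ κ / η)`. -/
noncomputable def intFactor (δ : ℝ) (η κ : ℝ → ℝ) (t : ℝ) : ℝ :=
  Real.exp (∫ r in (0 : ℝ)..t, δ * (κ r / η r))

theorem intFactor_pos (δ : ℝ) (η κ : ℝ → ℝ) (t : ℝ) : 0 < intFactor δ η κ t := Real.exp_pos _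

theorem intFactor_zero (δ : ℝ) (η κ : ℝ → ℝ) : intFactor δ η κ 0 = 1 := by
  simp [intFactor]

namespace IsMarket

variable {T δ : ℝ} {η κ lam : ℝ → ℝ}

theorem continuousOn_η (D : IsMarket T δ η κ lam) : ContinuousOn η (Icc 0 T) :=
  D.contDiffOn_η.continuousOn

theorem continuousOn_κ (D : IsMarket T δ η κ lam) : ContinuousOn κ (Icc 0 T) :=
  D.contDiffOn_κ.continuousOn

theorem continuousOn_inv_η (D : IsMarket T δ η κ lam) :
    ContinuousOn (fun t => (η t)⁻¹) (Icc 0 T) :=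
  D.continuousOn_η.inv₀ fun t ht => (D.η_pos t ht).ne'

theorem continuousOn_κ_div_η (D : IsMarket T δ η κ lam) :
    ContinuousOn (fun t => κ t / η t) (Icc 0 T) :=
  D.continuousOn_κ.div D.continuousOn_η fun t ht => (D.η_pos t ht).ne'

theorem intervalIntegrable_lam (D : IsMarket T δ η κ lam) : IntervalIntegrable lam volume 0 T := by
  rw [intervalIntegrable_iff_integrableOn_Icc_of_le D.T_pos.le]
  exact D.memLp_lam.integrable le_top

theorem exists_bound_lam (D : IsMarket T δ η κ lam) :
    ∃ L, 0 ≤ L ∧ ∀ᵐ s, s ∈ Icc 0 T → |lam s| ≤ L := by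
  have h := D.memLp_lam
  have h2 := (ae_restrict_iff' measurableSet_Icc).1 (ae_le_eLpNormEssSup (f := lam)
    (μ := volume.restrict (Icc 0 T)))
  have h3 : eLpNormEssSup lam (volume.restrict (Icc 0 T)) < ⊤ := by
    simpa using h.eLpNorm_lt_top
  refine ⟨(eLpNormEssSup lam (volume.restrict (Icc 0 T))).toReal, ENNReal.toReal_nonneg, ?_⟩
  filter_upwards [h2] with s hs hsm
  have := ENNReal.toReal_mono h3.ne (hs hsm)
  simpa using this

theorem ae_lam_nonneg (D : IsMarket T δ η κ lam) : ∀ᵐ s, s ∈ Icc 0 T → 0 ≤ lam s :=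
  (ae_restrict_iff' measurableSet_Icc).1 D.lam_nonneg

theorem exists_bound {f : ℝ → ℝ} {a b : ℝ} (hf : ContinuousOn f (Icc a b)) :
    ∃ C, 0 ≤ C ∧ ∀ t ∈ Icc a b, |f t| ≤ C := by
  obtain ⟨C, hC⟩ := isCompact_Icc.exists_bound_of_continuousOn hf
  exact ⟨|C|, abs_nonneg _, fun t ht => (hC t ht).trans (le_abs_self C)⟩

theorem exists_linearSolution (D : IsMarket T δ η κ lam) (u₀ w₀ : ℝ) :
    ∃ u w, IsLinearSolution T δ η κ lam u w ∧ u 0 = u₀ ∧ w 0 = w₀ := by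
  obtain ⟨L, hL0, hL⟩ := D.exists_bound_lam
  obtain ⟨C1, hC1, h1⟩ := exists_bound D.continuousOn_inv_η
  obtain ⟨C2, hC2, h2⟩ := exists_bound (continuousOn_const.mul D.continuousOn_κ_div_η :
    ContinuousOn (fun t => δ * (κ t / η t)) (Icc 0 T))
  have hT := D.T_pos.le
  have hint1 {z : ℝ → ℝ} (hz : Continuous z) :
      IntervalIntegrable (fun s => z s / η s) volume 0 T := by
    apply ContinuousOn.intervalIntegrable
    rw [uIcc_of_le hT]
    exact hz.continuousOn.div D.continuousOn_η fun t ht => (D.η_pos t ht).ne'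
  have hint2 {z y : ℝ → ℝ} (hz : Continuous z) (hy : Continuous y) :
      IntervalIntegrable (fun s => -(δ * (κ s / η s)) * z s + lam s * y s) volume 0 T := by
    refine IntervalIntegrable.add ?_ (D.intervalIntegrable_lam.mul_continuousOn hy.continuousOn)
    apply ContinuousOn.intervalIntegrable
    rw [uIcc_of_le hT]
    exact (continuousOn_const.mul D.continuousOn_κ_div_η).neg.mul hz.continuousOn
  have hF : ∀ x : ℝ → ℝ × ℝ, Continuous x → IntervalIntegrable (fun s =>
      ((x s).2 / η s, -(δ * (κ s / η s)) * (x s).2 + lam s * (x s).1)) volume 0 T := fun x hx => by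
    have e1 := hint1 hx.snd
    have e2 := hint2 hx.snd hx.fst
    rw [intervalIntegrable_iff] at *
    exact e1.prodMk e2
  obtain ⟨x, hx, hxe⟩ := exists_integral_solution (E := ℝ × ℝ) hT (left_mem_Icc.2 hT)
    (fun s z => (z.2 / η s, -(δ * (κ s / η s)) * z.2 + lam s * z.1)) hF
    (K := C1 + C2 + L) (by positivity) (by
      filter_upwards [hL] with s hs hsm y z
      have e1 := h1 s hsm
      have e2 : |δ * (κ s / η s)| ≤ C2 := h2 s hsm
      have e3 := hs hsm
      have n1 : |y.1 - z.1| ≤ ‖y - z‖ := norm_fst_le (y - z)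
      have n2 : |y.2 - z.2| ≤ ‖y - z‖ := norm_snd_le (y - z)
      have hn := norm_nonneg (y - z)
      rw [Prod.norm_def, max_le_iff]
      constructor
      · have : (y.2 / η s - z.2 / η s) = (η s)⁻¹ * (y.2 - z.2) := by ring
        simp only [Prod.fst_sub, this, Real.norm_eq_abs, abs_mul]
        calc |(η s)⁻¹| * |y.2 - z.2| ≤ C1 * ‖y - z‖ := by gcongr
          _ ≤ _ := by nlinarith [mul_nonneg hC2 hn, mul_nonneg hL0 hn]
      · have : (-(δ * (κ s / η s)) * y.2 + lam s * y.1 - (-(δ * (κ s / η s)) * z.2 + lam s * z.1))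
            = -((δ * (κ s / η s)) * (y.2 - z.2)) + lam s * (y.1 - z.1) := by ring
        simp only [Prod.snd_sub, this, Real.norm_eq_abs]
        refine (abs_add_le _ _).trans ?_
        rw [abs_neg, abs_mul (δ * (κ s / η s)), abs_mul (lam s)]
        calc |δ * (κ s / η s)| * |y.2 - z.2| + |lam s| * |y.1 - z.1|
            ≤ C2 * ‖y - z‖ + L * ‖y - z‖ := by gcongr
          _ ≤ _ := by nlinarith [mul_nonneg hC1 hn]) (u₀, w₀)
  have hx0 : x 0 = (u₀, w₀) := by simpa using hxe 0 (left_mem_Icc.2 hT)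
  refine ⟨fun t => (x t).1, fun t => (x t).2, ⟨?_, ?_⟩, by simp [hx0], by simp [hx0]⟩
  · refine HasACDerivOn.of_integral hT (left_mem_Icc.2 hT) (hint1 hx.snd) fun t ht => ?_
    have hi := (hF x hx).mono_set (c := 0) (d := t) (by
      rw [uIcc_of_le hT]; exact uIcc_subset_Icc (left_mem_Icc.2 hT) ht)
    have := (ContinuousLinearMap.fst ℝ ℝ ℝ).intervalIntegral_comp_comm hi
    simp only [ContinuousLinearMap.coe_fst'] at this
    rw [this, hxe t ht, hx0]; simp
  · refine HasACDerivOn.of_integral hT (left_mem_Icc.2 hT) (hint2 hx.snd hx.fst) fun t ht => ?_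
    have hi := (hF x hx).mono_set (c := 0) (d := t) (by
      rw [uIcc_of_le hT]; exact uIcc_subset_Icc (left_mem_Icc.2 hT) ht)
    have := (ContinuousLinearMap.snd ℝ ℝ ℝ).intervalIntegral_comp_comm hi
    simp only [ContinuousLinearMap.coe_snd'] at this
    rw [this, hxe t ht, hx0]; simp

theorem hasACDerivOn_intFactor (D : IsMarket T δ η κ lam) :
    HasACDerivOn (intFactor δ η κ) (fun t => δ * (κ t / η t) * intFactor δ η κ t) 0 T := by
  have h : IntervalIntegrable (fun t => δ * (κ t / η t)) volume 0 T := by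
    apply ContinuousOn.intervalIntegrable
    rw [uIcc_of_le D.T_pos.le]
    exact continuousOn_const.mul D.continuousOn_κ_div_η
  exact (HasACDerivOn.integral_right D.T_pos.le h).exp

end IsMarket

namespace IsLinearSolution

variable {T δ : ℝ} {η κ lam u w u' w' : ℝ → ℝ}

theorem add_const_mul (h : IsLinearSolution T δ η κ lam u w)
    (h' : IsLinearSolution T δ η κ lam u' w') (c : ℝ) :
    IsLinearSolution T δ η κ lam (fun t => u t + c * u' t) (fun t => w t + c * w' t) where
  fst := (h.fst.add (h'.fst.const_mul c)).congr_deriv (by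
    filter_upwards with x _; ring)
  snd := (h.snd.add (h'.snd.const_mul c)).congr_deriv (by
    filter_upwards with x _; ring)

/-- Liouville's formula: the system has trace `-δ κ / η`, which `intFactor` compensates. -/
theorem wronskian (D : IsMarket T δ η κ lam) (h : IsLinearSolution T δ η κ lam u w)
    (h' : IsLinearSolution T δ η κ lam u' w') {t : ℝ} (ht : t ∈ Icc 0 T) :
    intFactor δ η κ t * (w t * u' t - u t * w' t) = w 0 * u' 0 - u 0 * w' 0 := by
  have h1 := D.hasACDerivOn_intFactor.mul ((h.snd.mul h'.fst).sub (h.fst.mul h'.snd))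
  have h2 := h1.eq_of_ae_zero (by filter_upwards with x _; ring) ht (left_mem_Icc.2 D.T_pos.le)
  rw [h2, intFactor_zero, one_mul]

/-- Up to the first time `t₁` with `w ≤ 0`, `u` is nondecreasing, hence nonnegative; then `λ ≥ 0`
makes `intFactor · w` nondecreasing, so `w t₁` is still positive. -/
theorem snd_pos (D : IsMarket T δ η κ lam) (h : IsLinearSolution T δ η κ lam u w)
    (hu : 0 ≤ u 0) (hw : 0 < w 0) {t : ℝ} (ht : t ∈ Icc 0 T) : 0 < w t := by
  by_contra hcon
  set S := Icc 0 T ∩ w ⁻¹' Iic 0 with hS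
  have hScl : IsClosed S := h.snd.continuousOn.preimage_isClosed_of_isClosed isClosed_Icc isClosed_Iic
  have hSne : S.Nonempty := ⟨t, ht, not_lt.1 hcon⟩
  have hSbdd : BddBelow S := ⟨0, fun x hx => hx.1.1⟩
  have h1 := hScl.csInf_mem hSne hSbdd
  set t₁ := sInf S
  have hpos : ∀ s ∈ Ico 0 t₁, 0 < w s := fun s hs => by
    by_contra hc
    exact (not_lt.2 (csInf_le hSbdd ⟨⟨hs.1, hs.2.le.trans h1.1.2⟩, not_lt.1 hc⟩)) hs.2
  have hu1 : ∀ s ∈ Icc 0 t₁, 0 ≤ u s := fun s hs => by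
    refine hu.trans ((h.fst.mono le_rfl h1.1.1 h1.1.2).le_of_ae_nonneg ?_ le_rfl hs.1 hs.2)
    filter_upwards with x hx
    exact div_nonneg (hpos x ⟨hx.1.le, hx.2⟩).le
      (D.η_pos x ⟨hx.1.le, hx.2.le.trans h1.1.2⟩).le
  have h2 := ((D.hasACDerivOn_intFactor.mul h.snd).mono le_rfl h1.1.1 h1.1.2).le_of_ae_nonneg (by
    filter_upwards [D.ae_lam_nonneg] with x hx hxm
    have e1 := hx ⟨hxm.1.le, hxm.2.le.trans h1.1.2⟩
    have e2 := hu1 x ⟨hxm.1.le, hxm.2.le⟩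
    have e3 := (intFactor_pos δ η κ x).le
    have : 0 ≤ intFactor δ η κ x * (lam x * u x) := by positivity
    linarith) le_rfl h1.1.1 le_rfl
  have h3 : w t₁ ≤ 0 := h1.2
  rw [intFactor_zero, one_mul] at h2
  have := mul_nonpos_of_nonneg_of_nonpos (intFactor_pos δ η κ t₁).le h3
  linarith

end IsLinearSolution

end LiquidationGame

/-! ### Fundamental system, solution of the Riccati equation, identification of `h^δ` and `α^δ_T`.
-/

namespace LiquidationGame

theorem HasACDerivOn.strictMonoOn {f f' : ℝ → ℝ} {a b : ℝ} (hf : HasACDerivOn f f' a b)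
    (h : ∀ x ∈ Ioo a b, 0 < f' x) : StrictMonoOn f (Icc a b) := by
  intro s hs t ht hst
  have h1 := hf.integral_eq_sub hs.1 hst.le ht.2
  have h2 : 0 < ∫ x in s..t, f' x :=
    intervalIntegral.intervalIntegral_pos_of_pos_on
      (hf.mono hs.1 hst.le ht.2).intervalIntegrable
      (fun x hx => h x ⟨hs.1.trans_lt hx.1, hx.2.trans_le ht.2⟩) hst
  linarith

/-- Fundamental system of the linearized Riccati equation: `h` vanishes at `0`, `u` vanishes at
`T`, and the Wronskian is normalized to `1` at `0`. -/
structure IsFundamentalSystem (T δ : ℝ) (η κ lam h w u v : ℝ → ℝ) : Prop where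
  sol_h : IsLinearSolution T δ η κ lam h w
  sol_u : IsLinearSolution T δ η κ lam u v
  h_zero : h 0 = 0
  w_zero : w 0 = 1
  w_pos : ∀ t ∈ Icc 0 T, 0 < w t
  h_pos : ∀ t ∈ Ioc 0 T, 0 < h t
  u_zero : u 0 = 1
  u_T : u T = 0
  u_pos : ∀ t ∈ Ico 0 T, 0 < u t
  v_T : v T < 0

variable {T δ : ℝ} {η κ lam h w u v A : ℝ → ℝ}

/-- Take `h` with data `(0, 1)` and an auxiliary positive `k` with data `(1, 1)`. The Wronskian
makes `h / k` strictly increasing, so the combination of `k` and `h` vanishing at `T` is positive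
before `T`. At `T` the Wronskian reduces to `-h v` up to a positive factor, which gives `v T < 0`.
-/
theorem IsMarket.exists_fundamentalSystem (D : IsMarket T δ η κ lam) :
    ∃ h w u v, IsFundamentalSystem T δ η κ lam h w u v := by
  have hT := D.T_pos
  have hT0 : (0 : ℝ) ∈ Icc 0 T := left_mem_Icc.2 hT.le
  have hTT : T ∈ Icc 0 T := right_mem_Icc.2 hT.le
  obtain ⟨h, w, hs, h0, w0⟩ := D.exists_linearSolution 0 1
  obtain ⟨k, z, ks, k0, z0⟩ := D.exists_linearSolution 1 1
  have wpos : ∀ t ∈ Icc 0 T, 0 < w t := fun t ht =>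
    hs.snd_pos D h0.ge (by rw [w0]; exact one_pos) ht
  have zpos : ∀ t ∈ Icc 0 T, 0 < z t := fun t ht =>
    ks.snd_pos D (by rw [k0]; exact zero_le_one) (by rw [z0]; exact one_pos) ht
  have hmono := hs.fst.strictMonoOn fun x hx =>
    div_pos (wpos x (Ioo_subset_Icc_self hx)) (D.η_pos x (Ioo_subset_Icc_self hx))
  have kmono := ks.fst.strictMonoOn fun x hx =>
    div_pos (zpos x (Ioo_subset_Icc_self hx)) (D.η_pos x (Ioo_subset_Icc_self hx))
  have hpos : ∀ t ∈ Ioc 0 T, 0 < h t := fun t ht => by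
    rw [← h0]; exact hmono hT0 (Ioc_subset_Icc_self ht) ht.1
  have kpos : ∀ t ∈ Icc 0 T, 0 < k t := fun t ht =>
    zero_lt_one.trans_le (by rw [← k0]; exact kmono.monotoneOn hT0 ht ht.1)
  have hW : ∀ t ∈ Icc 0 T, intFactor δ η κ t * (w t * k t - h t * z t) = 1 := fun t ht => by
    rw [hs.wronskian D ks ht, w0, k0, h0]; norm_num
  have rmono : StrictMonoOn (fun t => h t * (k t)⁻¹) (Icc 0 T) := by
    refine (hs.fst.mul (ks.fst.inv fun x hx => (kpos x hx).ne')).strictMonoOn fun x hx => ?_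
    have hx' := Ioo_subset_Icc_self hx
    have e1 := D.η_pos x hx'
    have e2 := kpos x hx'
    have e3 : 0 < w x * k x - h x * z x :=
      pos_of_mul_pos_right ((hW x hx').symm ▸ one_pos) (intFactor_pos δ η κ x).le
    have : w x / η x * (k x)⁻¹ + h x * (-(z x / η x) / k x ^ 2) =
        (w x * k x - h x * z x) / (η x * k x ^ 2) := by
      field_simp
      ring
    rw [this]
    positivity
  have hTpos := hpos T ⟨hT, le_rfl⟩
  set β := -(k T / h T) with hβ
  have us := ks.add_const_mul hs β
  have uT : k T + β * h T = 0 := by rw [hβ]; field_simp; ring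
  have u0 : k 0 + β * h 0 = 1 := by rw [k0, h0]; ring
  refine ⟨h, w, _, _, hs, us, h0, w0, wpos, hpos, u0, uT, fun t ht => ?_, ?_⟩
  · have ht' := Ico_subset_Icc_self ht
    have := rmono ht' hTT ht.2
    have e1 := kpos t ht'
    have e2 := kpos T hTT
    simp only [← div_eq_mul_inv] at this
    rw [div_lt_div_iff₀ e1 e2] at this
    have e3 : k t + β * h t = (k t * h T - k T * h t) / h T := by
      rw [hβ]; field_simp; ring
    rw [e3]
    exact div_pos (by linarith) hTpos
  · have := hs.wronskian D us hTT
    rw [uT, u0, w0, h0] at this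
    by_contra hc
    have e1 : 0 ≤ intFactor δ η κ T * (h T * (z T + β * w T)) :=
      mul_nonneg (intFactor_pos δ η κ T).le (mul_nonneg hTpos.le (not_lt.1 hc))
    linarith

namespace IsFundamentalSystem

theorem wronskian (S : IsFundamentalSystem T δ η κ lam h w u v) (D : IsMarket T δ η κ lam) {t : ℝ}
    (ht : t ∈ Icc 0 T) : intFactor δ η κ t * (w t * u t - h t * v t) = 1 := by
  rw [S.sol_h.wronskian D S.sol_u ht, S.w_zero, S.u_zero, S.h_zero]; norm_num

/-- The logarithmic substitution `A = -η u' / u = -v / u` linearizes the equation; the blow-up comes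
from `u ↓ 0` and `v T < 0`. -/
theorem isRiccatiSolution (S : IsFundamentalSystem T δ η κ lam h w u v)
    (D : IsMarket T δ η κ lam) : IsRiccatiSolution T δ η κ lam (fun t => -v t * (u t)⁻¹) := by
  have hT := D.T_pos
  have hTT : T ∈ Icc 0 T := right_mem_Icc.2 hT.le
  have hsub : 𝓝[<] T ≤ 𝓝[Icc 0 T] T := by
    rw [← nhdsWithin_Ico_eq_nhdsLT hT]
    exact nhdsWithin_mono _ Ico_subset_Icc_self
  refine ⟨?_, fun t ht => ?_, ?_⟩
  · exact (S.sol_u.snd.continuousOn.mono Ico_subset_Icc_self).neg.mul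
      ((S.sol_u.fst.continuousOn.mono Ico_subset_Icc_self).inv₀ fun t ht => (S.u_pos t ht).ne')
  · have h1 := S.sol_u.fst.mono le_rfl ht.1 ht.2.le
    have h2 := S.sol_u.snd.mono le_rfl ht.1 ht.2.le
    have h3 := h2.neg.mul (h1.inv fun x hx => (S.u_pos x ⟨hx.1, hx.2.trans_lt ht.2⟩).ne')
    have h4 := h3.congr_deriv (g' := fun s => (-v s * (u s)⁻¹) ^ 2 / η s -
        δ * (κ s / η s) * (-v s * (u s)⁻¹) - lam s) (by
      filter_upwards with x hx
      have e1 := (S.u_pos x ⟨hx.1.le, hx.2.trans ht.2⟩).ne'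
      have e2 := (D.η_pos x ⟨hx.1.le, hx.2.le.trans ht.2.le⟩).ne'
      field_simp
      ring)
    rw [h4.integral_eq_sub le_rfl ht.1 le_rfl]
    ring
  · have hv : Tendsto (fun t => -v t) (𝓝[<] T) (𝓝 (-v T)) :=
      ((S.sol_u.snd.continuousOn T hTT).mono_left hsub).neg
    have hu : Tendsto u (𝓝[<] T) (𝓝[>] 0) := by
      refine tendsto_nhdsWithin_iff.2 ⟨?_, ?_⟩
      · rw [← S.u_T]; exact (S.sol_u.fst.continuousOn T hTT).mono_left hsub
      · filter_upwards [Ico_mem_nhdsLT hT] with t ht using S.u_pos t ht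
    exact hv.pos_mul_atTop (neg_pos.2 S.v_T) (tendsto_inv_nhdsGT_zero.comp hu)

end IsFundamentalSystem

theorem IsRiccatiSolution.hasACDerivOn (hA : IsRiccatiSolution T δ η κ lam A)
    (D : IsMarket T δ η κ lam) {t : ℝ} (ht : t ∈ Ico 0 T) :
    HasACDerivOn A (fun s => (A s) ^ 2 / η s - δ * (κ s / η s) * A s - lam s) 0 t := by
  have hsub : Icc 0 t ⊆ Icc 0 T := Icc_subset_Icc_right ht.2.le
  have hAc : ContinuousOn A (Icc 0 t) := hA.1.mono fun x hx => ⟨hx.1, hx.2.trans_lt ht.2⟩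
  refine HasACDerivOn.of_integral ht.1 (left_mem_Icc.2 ht.1) ?_ fun s hs =>
    hA.2.1 s ⟨hs.1, hs.2.trans_lt ht.2⟩
  refine IntervalIntegrable.sub ?_ (D.intervalIntegrable_lam.mono_set ?_)
  · apply ContinuousOn.intervalIntegrable
    rw [uIcc_of_le ht.1]
    exact ((hAc.pow 2).div (D.continuousOn_η.mono hsub) fun x hx => (D.η_pos x (hsub hx)).ne').sub
      ((continuousOn_const.mul (D.continuousOn_κ_div_η.mono hsub)).mul hAc)
  · rw [uIcc_of_le ht.1, uIcc_of_le D.T_pos.le]; exact hsub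

theorem IsRiccatiSolution.intervalIntegrable_div (hA : IsRiccatiSolution T δ η κ lam A)
    (D : IsMarket T δ η κ lam) {t : ℝ} (ht : t ∈ Ico 0 T) :
    IntervalIntegrable (fun s => A s / η s) volume 0 t := by
  have hsub : Icc 0 t ⊆ Icc 0 T := Icc_subset_Icc_right ht.2.le
  have hAc : ContinuousOn A (Icc 0 t) := hA.1.mono fun x hx => ⟨hx.1, hx.2.trans_lt ht.2⟩
  apply ContinuousOn.intervalIntegrable
  rw [uIcc_of_le ht.1]
  exact hAc.div (D.continuousOn_η.mono hsub) fun x hx => (D.η_pos x (hsub hx)).ne'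

/-- A solution of the linear system which starts on the graph of a Riccati solution stays there. -/
theorem IsRiccatiSolution.linearSolution_eq (hA : IsRiccatiSolution T δ η κ lam A)
    (D : IsMarket T δ η κ lam) (hu : IsLinearSolution T δ η κ lam u v)
    (h0 : A 0 * u 0 + v 0 = 0) {t : ℝ} (ht : t ∈ Ico 0 T) :
    A t * u t + v t = 0 ∧ u t * Real.exp (∫ r in (0 : ℝ)..t, A r / η r) = u 0 := by
  have hsub : Icc 0 t ⊆ Icc 0 T := Icc_subset_Icc_right ht.2.le
  have h1 := hu.fst.mono le_rfl ht.1 ht.2.le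
  have h2 := hu.snd.mono le_rfl ht.1 ht.2.le
  have hi := hA.intervalIntegrable_div D ht
  have hκ : IntervalIntegrable (fun s => δ * (κ s / η s)) volume 0 t := by
    apply ContinuousOn.intervalIntegrable
    rw [uIcc_of_le ht.1]
    exact continuousOn_const.mul (D.continuousOn_κ_div_η.mono hsub)
  have key : ∀ s ∈ Icc 0 t, A s * u s + v s = 0 := fun s hs => by
    -- `A u + v` solves the homogeneous linear equation with rate `(A - δ κ) / η`, so it stays zero.
    have hY := (((hA.hasACDerivOn D ht).mul h1).add h2).mul
      (HasACDerivOn.integral_right ht.1 (hi.sub hκ)).neg.exp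
    have := hY.eq_of_ae_zero (by
      filter_upwards with x hx
      have e2 := (D.η_pos x (hsub (Ioo_subset_Icc_self hx))).ne'
      field_simp
      ring) hs (left_mem_Icc.2 ht.1)
    rw [h0, zero_mul] at this
    exact (mul_eq_zero.1 this).resolve_right (Real.exp_pos _).ne'
  refine ⟨key t (right_mem_Icc.2 ht.1), ?_⟩
  have hU := h1.mul (HasACDerivOn.integral_right ht.1 hi).exp
  have := hU.eq_of_ae_zero (by
      filter_upwards with x hx
      have e2 := (D.η_pos x (hsub (Ioo_subset_Icc_self hx))).ne'
      have e3 : v x = -(A x * u x) := by linarith [key x (Ioo_subset_Icc_self hx)]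
      rw [e3]
      field_simp
      ring) (right_mem_Icc.2 ht.1) (left_mem_Icc.2 ht.1)
  simpa using this

namespace IsFundamentalSystem

/-- Uniqueness for the singular problem. Any solution has the form `-(v + β w) / (u + β h)`; for `β
≠ 0` the denominator does not vanish at `T` and the quotient has a finite limit, so `β = 0`. -/
theorem riccati_mul_add (S : IsFundamentalSystem T δ η κ lam h w u v) (D : IsMarket T δ η κ lam)
    (hA : IsRiccatiSolution T δ η κ lam A) {t : ℝ} (ht : t ∈ Ico 0 T) :
    A t * u t + v t = 0 ∧ u t * Real.exp (∫ r in (0 : ℝ)..t, A r / η r) = 1 := by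
  have hT := D.T_pos
  have hTT : T ∈ Icc 0 T := right_mem_Icc.2 hT.le
  have hsub : 𝓝[<] T ≤ 𝓝[Icc 0 T] T := by
    rw [← nhdsWithin_Ico_eq_nhdsLT hT]
    exact nhdsWithin_mono _ Ico_subset_Icc_self
  -- With this `β` the solution `(u + β h, v + β w)` starts on the graph of `A`, as `u 0 = w 0 = 1`
  -- and `h 0 = 0`.
  set β := -A 0 - v 0 with hβ
  have hl := S.sol_u.add_const_mul S.sol_h β
  have h0 : A 0 * (u 0 + β * h 0) + (v 0 + β * w 0) = 0 := by
    rw [S.u_zero, S.h_zero, S.w_zero, hβ]; ring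
  have key := fun s (hs : s ∈ Ico 0 T) => hA.linearSolution_eq D hl h0 hs
  have hβ0 : β = 0 := by
    by_contra hne
    have hne' : u T + β * h T ≠ 0 := by
      rw [S.u_T, zero_add]
      exact mul_ne_zero hne (S.h_pos T ⟨hT, le_rfl⟩).ne'
    have hlim : Tendsto (fun t => -(v t + β * w t) / (u t + β * h t)) (𝓝[<] T)
        (𝓝 (-(v T + β * w T) / (u T + β * h T))) :=
      ((hl.snd.continuousOn T hTT).mono_left hsub).neg.div
        ((hl.fst.continuousOn T hTT).mono_left hsub) hne'
    refine not_tendsto_nhds_of_tendsto_atTop hA.2.2 _ (hlim.congr' ?_)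
    filter_upwards [Ico_mem_nhdsLT hT] with s hs
    obtain ⟨k1, k2⟩ := key s hs
    have hpos : u s + β * h s ≠ 0 := fun h0 => by
      rw [h0, zero_mul, S.u_zero, S.h_zero] at k2
      norm_num at k2
    rw [div_eq_iff hpos]
    linarith
  have := key t ht
  simp only [hβ0, zero_mul, add_zero, S.u_zero] at this
  exact this

theorem isRiccatiSolution_riccati (S : IsFundamentalSystem T δ η κ lam h w u v)
    (D : IsMarket T δ η κ lam) : IsRiccatiSolution T δ η κ lam (riccati T δ η κ lam) :=
  Classical.epsilon_spec ⟨_, S.isRiccatiSolution D⟩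

theorem eqOn_riccati (S : IsFundamentalSystem T δ η κ lam h w u v)
    (D : IsMarket T δ η κ lam) (hA : IsRiccatiSolution T δ η κ lam A) :
    EqOn A (riccati T δ η κ lam) (Ico 0 T) := fun t ht => by
  have h1 := (S.riccati_mul_add D hA ht).1
  have h2 := (S.riccati_mul_add D (S.isRiccatiSolution_riccati D) ht).1
  exact mul_right_cancel₀ (S.u_pos t ht).ne' (by linarith)

/-- Since `exp (∫ A / η) = 1 / u`, the integrand defining `h^δ` is `1 / (η u² · intFactor)`, which
by the Wronskian is the derivative of `h / u`. The exponential prefactor is `u`. -/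
theorem hFun_eq (S : IsFundamentalSystem T δ η κ lam h w u v)
    (D : IsMarket T δ η κ lam) : EqOn (hFun T δ η κ lam) h (Ico 0 T) := fun t ht => by
  have hA := S.isRiccatiSolution_riccati D
  have hr : ∀ s ∈ Ico 0 T, Real.exp (∫ r in (0 : ℝ)..s, riccati T δ η κ lam r / η r) = (u s)⁻¹ :=
    fun s hs => eq_inv_of_mul_eq_one_right (S.riccati_mul_add D hA hs).2
  have hsub : Icc 0 t ⊆ Icc 0 T := Icc_subset_Icc_right ht.2.le
  have h1 := S.sol_u.fst.mono le_rfl ht.1 ht.2.le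
  have h2 := S.sol_h.fst.mono le_rfl ht.1 ht.2.le
  have hq := h2.mul (h1.inv fun x hx => (S.u_pos x ⟨hx.1, hx.2.trans_lt ht.2⟩).ne')
  have hint : ∫ s in (0 : ℝ)..t, 1 / η s *
      Real.exp (∫ r in (0 : ℝ)..s, (2 * riccati T δ η κ lam r - δ * κ r) / η r) =
      h t * (u t)⁻¹ := by
    have := hq.integral_eq_sub le_rfl ht.1 le_rfl
    rw [S.h_zero, zero_mul, sub_zero] at this
    rw [← this]
    refine intervalIntegral.integral_congr fun s hs => ?_
    rw [uIcc_of_le ht.1] at hs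
    have hs' : s ∈ Ico 0 T := ⟨hs.1, hs.2.trans_lt ht.2⟩
    have e1 := (D.η_pos s (hsub hs)).ne'
    have e2 := (S.u_pos s hs').ne'
    have e3 := S.wronskian D (hsub hs)
    have hκ : IntervalIntegrable (fun s => δ * (κ s / η s)) volume 0 s := by
      apply ContinuousOn.intervalIntegrable
      rw [uIcc_of_le hs.1]
      exact continuousOn_const.mul (D.continuousOn_κ_div_η.mono
        (Icc_subset_Icc_right hs'.2.le))
    have e4 : ∫ r in (0 : ℝ)..s, (2 * riccati T δ η κ lam r - δ * κ r) / η r =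
        (∫ r in (0 : ℝ)..s, riccati T δ η κ lam r / η r) +
        (∫ r in (0 : ℝ)..s, riccati T δ η κ lam r / η r) - ∫ r in (0 : ℝ)..s, δ * (κ r / η r) := by
      have hi := hA.intervalIntegrable_div D hs'
      rw [← intervalIntegral.integral_add hi hi, ← intervalIntegral.integral_sub (hi.add hi) hκ]
      congr 1
      ext r
      ring
    have e5 : Real.exp (∫ r in (0 : ℝ)..s, (2 * riccati T δ η κ lam r - δ * κ r) / η r) =
        (u s)⁻¹ * (u s)⁻¹ * (w s * u s - h s * v s) := by
      rw [e4, Real.exp_sub, Real.exp_add, hr s hs']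
      change _ / intFactor δ η κ s = _
      rw [div_eq_iff (intFactor_pos δ η κ s).ne', mul_assoc, mul_comm _ (intFactor δ η κ s), e3,
        mul_one]
    simp only [e5]
    field_simp
    ring
  have e2 := (S.u_pos t ht).ne'
  rw [hFun, hint, Real.exp_neg, hr t ht]
  field_simp

theorem tendsto_hFun (S : IsFundamentalSystem T δ η κ lam h w u v)
    (D : IsMarket T δ η κ lam) : Tendsto (hFun T δ η κ lam) (𝓝[<] T) (𝓝 (h T)) := by
  have hT := D.T_pos
  have hsub : 𝓝[<] T ≤ 𝓝[Icc 0 T] T := by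
    rw [← nhdsWithin_Ico_eq_nhdsLT hT]
    exact nhdsWithin_mono _ Ico_subset_Icc_self
  refine ((S.sol_h.fst.continuousOn T (right_mem_Icc.2 hT.le)).mono_left hsub).congr' ?_
  filter_upwards [Ico_mem_nhdsLT hT] with s hs using (S.hFun_eq D hs).symm

theorem alphaT_eq (S : IsFundamentalSystem T δ η κ lam h w u v)
    (D : IsMarket T δ η κ lam) : alphaT T δ η κ lam = (h T)⁻¹ := by
  rw [alphaT, (S.tendsto_hFun D).limUnder_eq]

end IsFundamentalSystem

end LiquidationGame

/-! ### Sign preservation for backward Volterra equations. -/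

namespace LiquidationGame

/-- Positivity for linear backward Volterra equations with nonnegative memory kernel. -/
theorem nonneg_of_backward_volterra {φ Φ α β r : ℝ → ℝ} {a b C : ℝ}
    (hφ : HasACDerivOn φ (fun t => -(α t * φ t + β t * Φ t + r t)) a b)
    (hΦ : HasACDerivOn Φ (fun t => -φ t) a b) (hΦb : Φ b = 0)
    (hα : IntervalIntegrable α volume a b)
    (hβ : ∀ᵐ t, t ∈ Ioo a b → 0 ≤ β t ∧ β t ≤ C) (hr : ∀ᵐ t, t ∈ Ioo a b → 0 ≤ r t)
    (hb : 0 ≤ φ b) {t : ℝ} (ht : t ∈ Icc a b) :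
    0 ≤ φ t ∧ φ b ≤ φ t * Real.exp (-∫ s in t..b, α s) := by
  have hab := hφ.le
  have hPac := HasACDerivOn.integral_left hab hα
  have hψ := hφ.mul hPac.neg.exp
  obtain ⟨E₁, hE₁0, hE₁⟩ := IsMarket.exists_bound hPac.neg.exp.continuousOn
  obtain ⟨E₂, hE₂0, hE₂⟩ := IsMarket.exists_bound hPac.exp.continuousOn
  have hneg : ContinuousOn (fun s => max (-φ s) 0) (Icc a b) :=
    hφ.neg.continuousOn.sup continuousOn_const
  have hnint : ∀ s ∈ Icc a b, IntervalIntegrable (fun s => max (-φ s) 0) volume s b :=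
    fun s hs => by
      apply ContinuousOn.intervalIntegrable
      rw [uIcc_of_le hs.2]
      exact hneg.mono (Icc_subset_Icc_left hs.1)
  have hΦle : ∀ t ∈ Icc a b, ∀ s ∈ Icc t b, -(∫ x in t..b, max (-φ x) 0) ≤ Φ s :=
    fun t ht s hs => by
      have hs' : s ∈ Icc a b := ⟨ht.1.trans hs.1, hs.2⟩
      have h1 := hΦ.integral_eq_sub hs'.1 hs.2 le_rfl
      rw [hΦb] at h1
      have h2 : ∫ x in s..b, -φ x ≤ ∫ x in s..b, max (-φ x) 0 :=
        intervalIntegral.integral_mono_on hs.2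
          (hΦ.mono hs'.1 hs.2 le_rfl).intervalIntegrable (hnint s hs') fun x _ => le_max_left _ _
      have h3 : ∫ x in s..b, max (-φ x) 0 ≤ ∫ x in t..b, max (-φ x) 0 :=
        intervalIntegral.integral_mono_interval hs.1 hs.2 le_rfl
          (Eventually.of_forall fun x => le_max_right _ _) (hnint t ht)
      linarith
  -- Grönwall is applied to the negative part of `φ`. The memory term is at least `-|C|` times the
  -- integral of that negative part, and `E₁`, `E₂` bound the integrating factor and its inverse.
  -- The sign of `C` is not known, hence `|C|`.
  have key : ∀ t ∈ Icc a b, max (-φ t) 0 ≤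
      0 + (E₂ * (|C| * E₁ * (b - a))) * ∫ x in t..b, max (-φ x) 0 := fun t ht => by
    set N := ∫ x in t..b, max (-φ x) 0 with hN
    have hN0 : 0 ≤ N := intervalIntegral.integral_nonneg ht.2 fun x _ => le_max_right _ _
    have hba : 0 ≤ b - a := sub_nonneg.2 hab
    rw [zero_add]
    refine max_le ?_ (by positivity)
    have hZ := ((HasACDerivOn.const_mul_id ht.2 (|C| * N * E₁)).sub
      (hψ.mono ht.1 ht.2 le_rfl)).le_of_ae_nonneg (by
      filter_upwards [hβ, hr] with s hs1 hs2 hsm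
      have hs' : s ∈ Ioo a b := ⟨ht.1.trans_lt hsm.1, hsm.2⟩
      obtain ⟨b0, b1⟩ := hs1 hs'
      have r0 := hs2 hs'
      have e1 := hE₁ s (Ioo_subset_Icc_self hs')
      have e0 := Real.exp_pos (-∫ x in s..b, α x)
      rw [abs_of_pos e0] at e1
      have f1 := hΦle t ht s (Ioo_subset_Icc_self hsm)
      rw [← hN] at f1
      have g1 : -(|C| * N) ≤ β s * Φ s := by
        have : β s * N ≤ |C| * N := by gcongr; exact b1.trans (le_abs_self C)
        nlinarith [mul_le_mul_of_nonneg_left f1 b0]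
      have g2 : -(|C| * N * E₁) ≤ (β s * Φ s + r s) * Real.exp (-∫ x in s..b, α x) := by
        have g3 : 0 ≤ |C| * N := by positivity
        calc -(|C| * N * E₁) ≤ -(|C| * N * Real.exp (-∫ x in s..b, α x)) := by
              gcongr
          _ = -(|C| * N) * Real.exp (-∫ x in s..b, α x) := by ring
          _ ≤ _ := by gcongr; linarith
      linarith) le_rfl ht.2 le_rfl
    simp only [intervalIntegral.integral_same, neg_zero, Real.exp_zero, mul_one] at hZ
    have e2 := hE₂ t ht
    have e0 := Real.exp_pos (∫ x in t..b, α x)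
    rw [abs_of_pos e0] at e2
    have h1 : -(φ t * Real.exp (-∫ x in t..b, α x)) ≤ |C| * E₁ * (b - a) * N := by
      have : |C| * N * E₁ * (b - t) ≤ |C| * N * E₁ * (b - a) := by
        gcongr; exact ht.1
      nlinarith
    calc -φ t = Real.exp (∫ x in t..b, α x) * -(φ t * Real.exp (-∫ x in t..b, α x)) := by
          rw [Real.exp_neg]; field_simp
      _ ≤ Real.exp (∫ x in t..b, α x) * (|C| * E₁ * (b - a) * N) := by gcongr
      _ ≤ E₂ * (|C| * E₁ * (b - a) * N) := by gcongr
      _ = _ := by ring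
  have hnn : ∀ t ∈ Icc a b, 0 ≤ φ t := fun t ht => by
    have h1 := le_mul_exp_of_le_integral hab (by
      have : 0 ≤ b - a := sub_nonneg.2 hab
      positivity) hneg key ht
    rw [zero_mul] at h1
    have := (le_max_left (-φ t) 0).trans h1
    linarith
  refine ⟨hnn t ht, ?_⟩
  have hΦ0 : ∀ s ∈ Icc a b, 0 ≤ Φ s := fun s hs => by
    have h1 := hΦ.neg.le_of_ae_nonneg (by
      filter_upwards with x hx
      rw [neg_neg]; exact hnn x (Ioo_subset_Icc_self hx)) hs.1 hs.2 le_rfl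
    rw [hΦb] at h1
    linarith
  -- Once `φ` and `Φ` are nonnegative, `φ exp (-∫ α)` is nonincreasing; this yields the quantitative
  -- lower bound.
  have h2 := hψ.neg.le_of_ae_nonneg (by
    filter_upwards [hβ, hr] with s hs1 hs2 hsm
    obtain ⟨b0, b1⟩ := hs1 hsm
    have r0 := hs2 hsm
    have e0 := Real.exp_pos (-∫ x in s..b, α x)
    have : 0 ≤ (β s * Φ s + r s) * Real.exp (-∫ x in s..b, α x) := by
      have := hΦ0 s (Ioo_subset_Icc_self hsm)
      positivity
    linarith) ht.1 ht.2 le_rfl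
  simp only [intervalIntegral.integral_same, neg_zero, Real.exp_zero, mul_one] at h2
  linarith

/-! ### Tails of `ν₀`, the terminal value, and its sign. -/

section Tails

variable (ν₀ : Measure ℝ)

/-- The decreasing rate `q₀(x) + p₀(0)`. -/
noncomputable def rate (x : ℝ) : ℝ := qTail ν₀ x + pTail ν₀ 0

/-- `E[ν₀] - (1 - q₀(0)) c - ∫₀ᶜ q₀(x) dx`. -/
noncomputable def residual (c : ℝ) : ℝ :=
  (∫ x, x ∂ν₀) - (1 - qTail ν₀ 0) * c - ∫ x in (0 : ℝ)..c, qTail ν₀ x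

/-- `E[ν₀] + ν₀({0}) c`. -/
noncomputable def level (c : ℝ) : ℝ :=
  (∫ x, x ∂ν₀) + (pTail ν₀ 0 + qTail ν₀ 0 - 1) * c

theorem qTail_nonneg (x : ℝ) : 0 ≤ qTail ν₀ x := measureReal_nonneg

theorem rate_nonneg (x : ℝ) : 0 ≤ rate ν₀ x := add_nonneg measureReal_nonneg measureReal_nonneg

theorem residual_zero : residual ν₀ 0 = ∫ x, x ∂ν₀ := by
  simp [residual]

variable [IsProbabilityMeasure ν₀]

theorem antitone_qTail : Antitone (qTail ν₀) := fun _ _ hxy =>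
  measureReal_mono (Ici_subset_Ici.2 hxy)

theorem qTail_le_one (x : ℝ) : qTail ν₀ x ≤ 1 := measureReal_le_one

theorem antitone_rate : Antitone (rate ν₀) := fun _ _ hxy =>
  add_le_add_left (antitone_qTail ν₀ hxy) _

theorem abs_rate_le (x : ℝ) : |rate ν₀ x| ≤ (2 : NNReal) := by
  rw [abs_of_nonneg (rate_nonneg ν₀ x), rate]
  have h1 : qTail ν₀ x ≤ 1 := measureReal_le_one
  have h2 : pTail ν₀ 0 ≤ 1 := measureReal_le_one
  push_cast
  linarith

/-- The conserved quantity involves the primitive of `rate`, the terminal value that of `q₀`;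
`level` absorbs the difference and becomes the value of the conserved quantity. -/
theorem residual_eq (c : ℝ) :
    residual ν₀ c = level ν₀ c - ∫ x in (0 : ℝ)..c, rate ν₀ x := by
  have : ∫ x in (0 : ℝ)..c, rate ν₀ x = (∫ x in (0 : ℝ)..c, qTail ν₀ x) + c * pTail ν₀ 0 := by
    simp only [rate]
    rw [intervalIntegral.integral_add (antitone_qTail ν₀).intervalIntegrable (by simp)]
    simp
  rw [this, residual, level]
  ring

theorem antitone_residual : Antitone (residual ν₀) := fun x y hxy => by
  have h1 : 0 ≤ ∫ z in x..y, qTail ν₀ z :=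
    intervalIntegral.integral_nonneg hxy fun z _ => qTail_nonneg ν₀ z
  have h2 := intervalIntegral.integral_add_adjacent_intervals
    ((antitone_qTail ν₀).intervalIntegrable (a := 0) (b := x) (μ := volume))
    ((antitone_qTail ν₀).intervalIntegrable (a := x) (b := y) (μ := volume))
  have h3 : (1 - qTail ν₀ 0) * x ≤ (1 - qTail ν₀ 0) * y :=
    mul_le_mul_of_nonneg_left hxy (sub_nonneg.2 (qTail_le_one ν₀ 0))
  simp only [residual]
  linarith

theorem abs_level_sub_le (c c' : ℝ) : |level ν₀ c - level ν₀ c'| ≤ |c - c'| := by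
  have h1 : qTail ν₀ 0 ≤ 1 := measureReal_le_one
  have h2 : pTail ν₀ 0 ≤ 1 := measureReal_le_one
  have h3 : 0 ≤ qTail ν₀ 0 := measureReal_nonneg
  have h4 : 0 ≤ pTail ν₀ 0 := measureReal_nonneg
  have : level ν₀ c - level ν₀ c' = (pTail ν₀ 0 + qTail ν₀ 0 - 1) * (c - c') := by
    simp only [level]; ring
  rw [this, abs_mul]
  refine mul_le_of_le_one_left (abs_nonneg _) ?_
  rw [abs_le]
  constructor <;> linarith

/-- If `ν₀` does not charge `(c, ∞)`, then `E[ν₀] ≤ ∫₀ᶜ q₀`. -/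
theorem residual_nonpos (hν₀ : Integrable (fun x : ℝ => x) ν₀) {c : ℝ} (hc : 0 ≤ c)
    (h : ν₀ (Ioi c) = 0) : residual ν₀ c ≤ 0 := by
  have h1 : ∫ x, x ∂ν₀ ≤ ∫ x, max x 0 ∂ν₀ :=
    integral_mono hν₀ hν₀.pos_part fun x => le_max_left _ _
  -- Layer-cake formula; beyond `c` the tail vanishes, leaving `∫₀ᶜ q₀`.
  have h2 : ∫ x, max x 0 ∂ν₀ = ∫ t in Ioi (0 : ℝ), ν₀.real {x | t ≤ max x 0} :=
    Integrable.integral_eq_integral_meas_le hν₀.pos_part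
      (Eventually.of_forall fun x => le_max_right _ _)
  have h3 : ∫ t in Ioi (0 : ℝ), ν₀.real {x | t ≤ max x 0} = ∫ t in Ioc (0 : ℝ) c, qTail ν₀ t := by
    rw [← integral_indicator measurableSet_Ioi, ← integral_indicator measurableSet_Ioc]
    congr 1
    ext t
    by_cases ht : 0 < t
    · have hset : {x : ℝ | t ≤ max x 0} = Ici t := by
        ext x
        simp [not_le.2 ht]
      by_cases htc : t ≤ c
      · rw [indicator_of_mem (show t ∈ Ioi (0 : ℝ) from ht),
          indicator_of_mem (show t ∈ Ioc 0 c from ⟨ht, htc⟩), hset]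
        rfl
      · rw [indicator_of_mem (show t ∈ Ioi (0 : ℝ) from ht),
          indicator_of_notMem (fun hh : t ∈ Ioc 0 c => htc hh.2), hset]
        have : ν₀ (Ici t) = 0 :=
          measure_mono_null (fun x (hx : t ≤ x) => (not_le.1 htc).trans_le hx) h
        simp [Measure.real, this]
    · rw [indicator_of_notMem (fun hh : t ∈ Ioi (0 : ℝ) => ht hh),
        indicator_of_notMem (fun hh : t ∈ Ioc 0 c => ht hh.1)]
  rw [← intervalIntegral.integral_of_le hc] at h3
  have h4 : 0 ≤ (1 - qTail ν₀ 0) * c := mul_nonneg (sub_nonneg.2 (qTail_le_one ν₀ 0)) hc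
  simp only [residual]
  linarith

theorem lt_sSup_support (hν₀ : Integrable (fun x : ℝ => x) ν₀) {c : ℝ} (hc : 0 ≤ c)
    (h : 0 < residual ν₀ c) :
    (c : EReal) < sSup ((fun x : ℝ => (x : EReal)) '' ν₀.support) := by
  by_contra hle
  rw [not_lt] at hle
  refine (residual_nonpos ν₀ hν₀ hc ?_).not_gt h
  refine measure_mono_null (fun x hx => ?_) (Measure.measure_compl_support (μ := ν₀))
  intro hxs
  have := (le_sSup (mem_image_of_mem (fun x : ℝ => (x : EReal)) hxs)).trans hle
  exact (EReal.coe_le_coe_iff.1 this).not_gt hx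

end Tails

end LiquidationGame

/-! ### Trajectories, the conserved quantity, and existence away from time `0`. -/

namespace LiquidationGame

/-- The coefficient `(λ + δ κ') / η` of the memory term. -/
noncomputable def memCoeff (T δ : ℝ) (η κ lam : ℝ → ℝ) (s : ℝ) : ℝ :=
  (lam s + δ * derivWithin κ (Icc 0 T) s) / η s

/-- The coefficient `(η' - δ κ) / η` of the local term. -/
noncomputable def driftCoeff (T δ : ℝ) (η κ : ℝ → ℝ) (s : ℝ) : ℝ :=
  (derivWithin η (Icc 0 T) s - δ * κ s) / η s

/-- The negative time derivative of a solution with value `m`, remaining mass `M`, and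
accumulated drift `g`. -/
noncomputable def slope (T δ : ℝ) (η κ lam : ℝ → ℝ) (ν₀ : Measure ℝ) (s m M g : ℝ) : ℝ :=
  κ s / η s * rate ν₀ g * m + memCoeff T δ η κ lam s * M + driftCoeff T δ η κ s * m

/-- Differential form of the backward equation on `[a, T]`, with `M_t = ∫ₜᵀ m` and
`g_t = c - ∫ₜᵀ κ h m`. -/
structure IsTrajectory (T δ : ℝ) (η κ lam h : ℝ → ℝ) (ν₀ : Measure ℝ) (a c : ℝ)
    (m M g : ℝ → ℝ) : Prop where
  deriv_m : HasACDerivOn m (fun s => -slope T δ η κ lam ν₀ s (m s) (M s) (g s)) a T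
  deriv_M : HasACDerivOn M (fun s => -m s) a T
  deriv_g : HasACDerivOn g (fun s => κ s * h s * m s) a T
  M_T : M T = 0
  g_T : g T = c
  m_T : m T = (h T)⁻¹ / η T * residual ν₀ c

variable {T δ : ℝ} {η κ lam h w u v : ℝ → ℝ} {ν₀ : Measure ℝ} {a c : ℝ} {m M g : ℝ → ℝ}

namespace IsMarket

theorem continuousOn_driftCoeff (D : IsMarket T δ η κ lam) :
    ContinuousOn (driftCoeff T δ η κ) (Icc 0 T) := by
  have h1 := D.contDiffOn_η.continuousOn_derivWithin (uniqueDiffOn_Icc D.T_pos) le_rfl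
  exact (h1.sub (continuousOn_const.mul D.continuousOn_κ)).div D.continuousOn_η
    fun t ht => (D.η_pos t ht).ne'

theorem intervalIntegrable_memCoeff (D : IsMarket T δ η κ lam) :
    IntervalIntegrable (memCoeff T δ η κ lam) volume 0 T := by
  have h1 := D.contDiffOn_κ.continuousOn_derivWithin (uniqueDiffOn_Icc D.T_pos) le_rfl
  have h2 := D.continuousOn_inv_η
  have h3 : ContinuousOn (fun s => δ * derivWithin κ (Icc 0 T) s) (Icc 0 T) :=
    continuousOn_const.mul h1
  have h5 : IntervalIntegrable (fun s => δ * derivWithin κ (Icc 0 T) s) volume 0 T := by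
    apply ContinuousOn.intervalIntegrable
    rw [uIcc_of_le D.T_pos.le]
    exact h3
  rw [← uIcc_of_le D.T_pos.le] at h2
  have h4 := (D.intervalIntegrable_lam.add h5).mul_continuousOn h2
  exact h4.congr fun s _ => (div_eq_mul_inv _ _).symm

theorem exists_bound_memCoeff (D : IsMarket T δ η κ lam) :
    ∃ C, 0 ≤ C ∧ ∀ᵐ s, s ∈ Icc 0 T →
      0 ≤ memCoeff T δ η κ lam s ∧ memCoeff T δ η κ lam s ≤ C := by
  obtain ⟨L, hL0, hL⟩ := D.exists_bound_lam
  have h1 := D.contDiffOn_κ.continuousOn_derivWithin (uniqueDiffOn_Icc D.T_pos) le_rfl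
  have h3 : ContinuousOn (fun s => δ * derivWithin κ (Icc 0 T) s) (Icc 0 T) :=
    continuousOn_const.mul h1
  obtain ⟨C1, hC1, b1⟩ := exists_bound D.continuousOn_inv_η
  obtain ⟨C2, hC2, b2⟩ := exists_bound h3
  refine ⟨(L + C2) * C1, by positivity, ?_⟩
  filter_upwards [hL, (ae_restrict_iff' measurableSet_Icc).1 D.lam_add_nonneg] with s hs1 hs2 hs
  refine ⟨div_nonneg (hs2 hs) (D.η_pos s hs).le, ?_⟩
  have e1 := (le_abs_self _).trans (hs1 hs)
  have e2 := (le_abs_self _).trans (b2 s hs)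
  have e3 := (le_abs_self _).trans (b1 s hs)
  have e4 := inv_nonneg.2 (D.η_pos s hs).le
  rw [memCoeff, div_eq_mul_inv]
  gcongr

/-- Only integrability of `m` is assumed, so that merely integrable solutions of (2) are covered;
the rate factor is bounded and measurable. -/
theorem intervalIntegrable_slope [IsProbabilityMeasure ν₀] (D : IsMarket T δ η κ lam) (ha : 0 ≤ a)
    (haT : a ≤ T)
    (hm : IntervalIntegrable m volume a T) (hM : ContinuousOn M (Icc a T))
    (hg : ContinuousOn g (Icc a T)) :
    IntervalIntegrable (fun s => slope T δ η κ lam ν₀ s (m s) (M s) (g s)) volume a T := by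
  have hsub : Icc a T ⊆ Icc 0 T := Icc_subset_Icc_left ha
  have hκη := D.continuousOn_κ_div_η.mono hsub
  have hdr := D.continuousOn_driftCoeff.mono hsub
  have hb : IntervalIntegrable (memCoeff T δ η κ lam) volume a T :=
    D.intervalIntegrable_memCoeff.mono_set (by
      rw [uIcc_of_le haT, uIcc_of_le D.T_pos.le]; exact hsub)
  have hr : IntervalIntegrable (fun s => rate ν₀ (g s) * m s) volume a T := by
    rw [intervalIntegrable_iff_integrableOn_Icc_of_le haT] at hm ⊢
    refine Integrable.bdd_mul (c := 2) hm ?_ (Eventually.of_forall fun s => ?_)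
    · exact ((antitone_rate ν₀).measurable.comp_aemeasurable
        (hg.aemeasurable measurableSet_Icc)).aestronglyMeasurable
    · exact abs_rate_le ν₀ (g s)
  rw [← uIcc_of_le haT] at hκη hdr hM
  have := ((hr.continuousOn_mul hκη).add (hb.mul_continuousOn hM)).add (hm.continuousOn_mul hdr)
  refine this.congr fun s _ => ?_
  simp only [slope]
  ring

end IsMarket

namespace IsTrajectory

theorem mono (H : IsTrajectory T δ η κ lam h ν₀ a c m M g) {b : ℝ} (hab : a ≤ b) (hb : b ≤ T) :
    IsTrajectory T δ η κ lam h ν₀ b c m M g where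
  deriv_m := H.deriv_m.mono hab hb le_rfl
  deriv_M := H.deriv_M.mono hab hb le_rfl
  deriv_g := H.deriv_g.mono hab hb le_rfl
  M_T := H.M_T
  g_T := H.g_T
  m_T := H.m_T

theorem m_eq (H : IsTrajectory T δ η κ lam h ν₀ a c m M g) {t : ℝ} (ht : t ∈ Icc a T) :
    m t = (h T)⁻¹ / η T * residual ν₀ c +
      ∫ s in t..T, slope T δ η κ lam ν₀ s (m s) (M s) (g s) := by
  have := H.deriv_m.integral_eq_sub ht.1 ht.2 le_rfl
  rw [intervalIntegral.integral_neg, H.m_T] at this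
  linarith

theorem M_eq (H : IsTrajectory T δ η κ lam h ν₀ a c m M g) {t : ℝ} (ht : t ∈ Icc a T) :
    M t = ∫ s in t..T, m s := by
  have := H.deriv_M.integral_eq_sub ht.1 ht.2 le_rfl
  rw [intervalIntegral.integral_neg, H.M_T] at this
  linarith

theorem g_eq (H : IsTrajectory T δ η κ lam h ν₀ a c m M g) {t : ℝ} (ht : t ∈ Icc a T) :
    g t = c - ∫ s in t..T, κ s * h s * m s := by
  have := H.deriv_g.integral_eq_sub ht.1 ht.2 le_rfl
  rw [H.g_T] at this
  linarith

/-- The integral equation implies its differential form. -/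
theorem of_integral [IsProbabilityMeasure ν₀] (D : IsMarket T δ η κ lam) (ha : 0 ≤ a)
    (haT : a ≤ T) (hh : ContinuousOn h (Icc 0 T)) (hm : IntervalIntegrable m volume a T)
    (H : ∀ t ∈ Icc a T, m t = (h T)⁻¹ / η T * residual ν₀ c +
      ∫ s in t..T, slope T δ η κ lam ν₀ s (m s) (∫ r in s..T, m r)
        (c - ∫ r in s..T, κ r * h r * m r)) :
    IsTrajectory T δ η κ lam h ν₀ a c m (fun t => ∫ s in t..T, m s)
      (fun t => c - ∫ s in t..T, κ s * h s * m s) := by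
  have hsub : Icc a T ⊆ Icc 0 T := Icc_subset_Icc_left ha
  have hκ := (D.continuousOn_κ.mul hh).mono hsub
  rw [← uIcc_of_le haT] at hκ
  have hM := HasACDerivOn.integral_left haT hm
  have hg := (HasACDerivOn.const haT c).sub
    (HasACDerivOn.integral_left haT (hm.continuousOn_mul hκ))
  have hs := D.intervalIntegrable_slope (ν₀ := ν₀) ha haT hm hM.continuousOn hg.continuousOn
  exact
    { deriv_m := by
        have := ((HasACDerivOn.const haT ((h T)⁻¹ / η T * residual ν₀ c)).add
          (HasACDerivOn.integral_left haT hs)).congr H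
        exact this.congr_deriv (by filter_upwards with x _; exact (zero_add _).symm)
      deriv_M := hM
      deriv_g := hg.congr_deriv (by filter_upwards with x _; simp)
      M_T := intervalIntegral.integral_same
      g_T := by simp
      m_T := by simpa using H T (right_mem_Icc.2 haT) }

variable [IsProbabilityMeasure ν₀]

/-- The conserved quantity of the system. -/
theorem conservation (H : IsTrajectory T δ η κ lam h ν₀ a c m M g) (D : IsMarket T δ η κ lam)
    (S : IsFundamentalSystem T δ η κ lam h w u v) (ha : 0 ≤ a) {t : ℝ} (ht : t ∈ Icc a T) :
    h t * (η t * m t + δ * κ t * M t) + w t * M t + ∫ x in (0 : ℝ)..g t, rate ν₀ x =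
      level ν₀ c := by
  have haT := ht.1.trans ht.2
  have hη := (HasACDerivOn.of_contDiffOn D.T_pos D.contDiffOn_η).mono ha haT le_rfl
  have hκ := (HasACDerivOn.of_contDiffOn D.T_pos D.contDiffOn_κ).mono ha haT le_rfl
  have hh := S.sol_h.fst.mono ha haT le_rfl
  have hw := S.sol_h.snd.mono ha haT le_rfl
  -- This is the only term that sees the jumps of `q₀`; the chain rule for monotone integrands
  -- differentiates it.
  have hQ := H.deriv_g.integral_antitone_comp (antitone_rate ν₀) (abs_rate_le ν₀)
  have hX := ((hh.mul ((hη.mul H.deriv_m).add ((hκ.const_mul δ).mul H.deriv_M))).add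
    (hw.mul H.deriv_M)).add hQ
  -- The slope equation gives `(η m + δ κ M)' = -κ ρ m - λ M`. Pairing with `(h, w)` cancels the
  -- terms in `λ`, `δ κ` and `w m`, and the rest, `-κ h ρ m`, is minus the derivative of `∫₀^g ρ`.
  have key := hX.eq_of_ae_zero (by
    filter_upwards with x hx
    have hx' : x ∈ Icc 0 T := ⟨ha.trans hx.1.le, hx.2.le⟩
    have e1 := (D.η_pos x hx').ne'
    simp only [slope, memCoeff, driftCoeff]
    field_simp
    ring) ht (right_mem_Icc.2 haT)
  refine key.trans ?_
  have hTT : T ∈ Icc 0 T := right_mem_Icc.2 D.T_pos.le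
  have e1 := (D.η_pos T hTT).ne'
  have e2 := (S.h_pos T ⟨D.T_pos, le_rfl⟩).ne'
  have e3 := residual_eq ν₀ c
  rw [H.M_T, H.g_T, H.m_T]
  have : h T * (η T * ((h T)⁻¹ / η T * residual ν₀ c) + δ * κ T * 0) = residual ν₀ c := by
    field_simp
    ring
  rw [this]
  linarith

end IsTrajectory

/-- The coefficient `δ κ h + w` of the remaining mass in the conserved quantity. -/
noncomputable def massCoeff (δ : ℝ) (κ h w : ℝ → ℝ) (t : ℝ) : ℝ := δ * κ t * h t + w t

namespace IsFundamentalSystem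

theorem continuousOn_massCoeff (S : IsFundamentalSystem T δ η κ lam h w u v)
    (D : IsMarket T δ η κ lam) : ContinuousOn (massCoeff δ κ h w) (Icc 0 T) :=
  ((continuousOn_const.mul D.continuousOn_κ).mul S.sol_h.fst.continuousOn).add
    S.sol_h.snd.continuousOn

theorem continuousOn_inv_mul (S : IsFundamentalSystem T δ η κ lam h w u v)
    (D : IsMarket T δ η κ lam) (ha : 0 < a) :
    ContinuousOn (fun t => (η t * h t)⁻¹) (Icc a T) := by
  have hsub : Icc a T ⊆ Icc 0 T := Icc_subset_Icc_left ha.le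
  refine ((D.continuousOn_η.mul S.sol_h.fst.continuousOn).mono hsub).inv₀ fun t ht => ?_
  exact mul_ne_zero (D.η_pos t (hsub ht)).ne' (S.h_pos t ⟨ha.trans_le ht.1, ht.2⟩).ne'

/-- The conservation law is used as a definition of `m`: inserting it into `M' = -m`, `g' = κ h m`
leaves a system for `(M, g)` that is Lipschitz as long as `h` stays away from `0`. -/
theorem exists_trajectory_of_pos (S : IsFundamentalSystem T δ η κ lam h w u v)
    (D : IsMarket T δ η κ lam) (ν₀ : Measure ℝ) [IsProbabilityMeasure ν₀] (ha : 0 < a)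
    (haT : a ≤ T) (c : ℝ) :
    ∃ m M g, IsTrajectory T δ η κ lam h ν₀ a c m M g := by
  have hsub : Icc a T ⊆ Icc 0 T := Icc_subset_Icc_left ha.le
  have hTT : T ∈ Icc a T := right_mem_Icc.2 haT
  have cρ := (S.continuousOn_massCoeff D).mono hsub
  have ci := S.continuousOn_inv_mul D ha
  have cκ := D.continuousOn_κ_div_η.mono hsub
  have hQl := lipschitzWith_integral (antitone_rate ν₀) (abs_rate_le ν₀)
  obtain ⟨C1, hC1, b1⟩ := IsMarket.exists_bound ci
  obtain ⟨C2, hC2, b2⟩ := IsMarket.exists_bound cκ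
  obtain ⟨C3, hC3, b3⟩ := IsMarket.exists_bound cρ
  -- `X` stands for `η h m`, with `z = (M, g)`.
  set X : ℝ → ℝ × ℝ → ℝ := fun s z =>
    level ν₀ c - massCoeff δ κ h w s * z.1 - ∫ x in (0 : ℝ)..z.2, rate ν₀ x with hX
  have cX : ∀ x : ℝ → ℝ × ℝ, Continuous x → ContinuousOn (fun s => X s (x s)) (Icc a T) :=
    fun x hx => (continuousOn_const.sub (cρ.mul hx.fst.continuousOn)).sub
      (hQl.continuous.comp hx.snd).continuousOn
  have i1 : ∀ x : ℝ → ℝ × ℝ, Continuous x →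
      IntervalIntegrable (fun s => -(X s (x s) * (η s * h s)⁻¹)) volume a T := fun x hx => by
    apply ContinuousOn.intervalIntegrable
    rw [uIcc_of_le haT]
    exact ((cX x hx).mul ci).neg
  have i2 : ∀ x : ℝ → ℝ × ℝ, Continuous x →
      IntervalIntegrable (fun s => κ s / η s * X s (x s)) volume a T := fun x hx => by
    apply ContinuousOn.intervalIntegrable
    rw [uIcc_of_le haT]
    exact cκ.mul (cX x hx)
  have hF : ∀ x : ℝ → ℝ × ℝ, Continuous x → IntervalIntegrable (fun s =>
      (-(X s (x s) * (η s * h s)⁻¹), κ s / η s * X s (x s))) volume a T := fun x hx => by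
    have e1 := i1 x hx
    have e2 := i2 x hx
    rw [intervalIntegrable_iff] at *
    exact e1.prodMk e2
  obtain ⟨x, hx, hxe⟩ := exists_integral_solution (E := ℝ × ℝ) haT hTT
    (fun s z => (-(X s z * (η s * h s)⁻¹), κ s / η s * X s z)) hF
    (K := (C1 + C2) * (C3 + 2)) (by positivity) (by
      filter_upwards with s hs y z
      have e1 := b1 s hs
      have e2 := b2 s hs
      have e3 := b3 s hs
      have n1 : |y.1 - z.1| ≤ ‖y - z‖ := norm_fst_le (y - z)
      have n2 : |y.2 - z.2| ≤ ‖y - z‖ := norm_snd_le (y - z)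
      have hn := norm_nonneg (y - z)
      have e4 : |(∫ x in (0 : ℝ)..y.2, rate ν₀ x) - ∫ x in (0 : ℝ)..z.2, rate ν₀ x| ≤
          2 * |y.2 - z.2| := by
        have := hQl.dist_le_mul y.2 z.2
        simpa [Real.dist_eq] using this
      have e5 : |X s y - X s z| ≤ (C3 + 2) * ‖y - z‖ := by
        have : X s y - X s z = -(massCoeff δ κ h w s * (y.1 - z.1)) -
            ((∫ x in (0 : ℝ)..y.2, rate ν₀ x) - ∫ x in (0 : ℝ)..z.2, rate ν₀ x) := by
          simp only [hX]; ring
        rw [this]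
        refine (abs_sub _ _).trans ?_
        rw [abs_neg, abs_mul]
        calc _ ≤ C3 * ‖y - z‖ + 2 * ‖y - z‖ := by
              refine add_le_add (by gcongr) (e4.trans (by gcongr))
          _ = _ := by ring
      rw [Prod.norm_def, max_le_iff]
      constructor
      · have : -(X s y * (η s * h s)⁻¹) - -(X s z * (η s * h s)⁻¹) =
            -((η s * h s)⁻¹ * (X s y - X s z)) := by ring
        simp only [Prod.fst_sub, this, Real.norm_eq_abs, abs_neg, abs_mul]
        rw [← abs_mul]
        calc |(η s * h s)⁻¹ * (X s y - X s z)| = |(η s * h s)⁻¹| * |X s y - X s z| := abs_mul _ _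
          _ ≤ C1 * ((C3 + 2) * ‖y - z‖) := by gcongr
          _ ≤ (C1 + C2) * (C3 + 2) * ‖y - z‖ := by
            rw [mul_assoc]; gcongr; linarith
      · have : κ s / η s * X s y - κ s / η s * X s z = κ s / η s * (X s y - X s z) := by ring
        simp only [Prod.snd_sub, this, Real.norm_eq_abs]
        calc |κ s / η s * (X s y - X s z)| = |κ s / η s| * |X s y - X s z| := abs_mul _ _
          _ ≤ C2 * ((C3 + 2) * ‖y - z‖) := by gcongr
          _ ≤ (C1 + C2) * (C3 + 2) * ‖y - z‖ := by
            rw [mul_assoc]; gcongr; linarith) (0, c)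
  have hxT : x T = (0, c) := by simpa using hxe T hTT
  have hM : HasACDerivOn (fun t => (x t).1) (fun s => -(X s (x s) * (η s * h s)⁻¹)) a T := by
    refine HasACDerivOn.of_integral haT hTT (i1 x hx) fun t ht => ?_
    have hi := (hF x hx).mono_set (c := T) (d := t) (by
      rw [uIcc_of_le haT]; exact uIcc_subset_Icc hTT ht)
    have := (ContinuousLinearMap.fst ℝ ℝ ℝ).intervalIntegral_comp_comm hi
    simp only [ContinuousLinearMap.coe_fst'] at this
    rw [this, hxe t ht, hxT]; simp
  have hg : HasACDerivOn (fun t => (x t).2) (fun s => κ s / η s * X s (x s)) a T := by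
    refine HasACDerivOn.of_integral haT hTT (i2 x hx) fun t ht => ?_
    have hi := (hF x hx).mono_set (c := T) (d := t) (by
      rw [uIcc_of_le haT]; exact uIcc_subset_Icc hTT ht)
    have := (ContinuousLinearMap.snd ℝ ℝ ℝ).intervalIntegral_comp_comm hi
    simp only [ContinuousLinearMap.coe_snd'] at this
    rw [this, hxe t ht, hxT]; simp
  have hη := (HasACDerivOn.of_contDiffOn D.T_pos D.contDiffOn_η).mono ha.le haT le_rfl
  have hκ := (HasACDerivOn.of_contDiffOn D.T_pos D.contDiffOn_κ).mono ha.le haT le_rfl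
  have hh := S.sol_h.fst.mono ha.le haT le_rfl
  have hw := S.sol_h.snd.mono ha.le haT le_rfl
  have hQ := hg.integral_antitone_comp (antitone_rate ν₀) (abs_rate_le ν₀)
  have hne : ∀ t ∈ Icc a T, η t * h t ≠ 0 := fun t ht =>
    mul_ne_zero (D.η_pos t (hsub ht)).ne' (S.h_pos t ⟨ha.trans_le ht.1, ht.2⟩).ne'
  -- Differentiating `m = X / (η h)` recovers the slope equation, again through the chain rule
  -- across jumps.
  have hXac := ((((HasACDerivOn.const haT (level ν₀ c)).sub
    ((((hκ.const_mul δ).mul hh).add hw).mul hM)).sub hQ)).mul ((hη.mul hh).inv hne)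
  refine ⟨fun t => X t (x t) * (η t * h t)⁻¹, fun t => (x t).1, fun t => (x t).2,
    hXac.congr_deriv ?_, hM, hg.congr_deriv ?_, by rw [hxT], by rw [hxT], ?_⟩
  · filter_upwards with t ht
    have e1 := (D.η_pos t (hsub (Ioo_subset_Icc_self ht))).ne'
    have e2 := (S.h_pos t ⟨ha.trans ht.1, ht.2.le⟩).ne'
    have e3 : level ν₀ c - (δ * κ t * h t + w t) * (x t).1 -
      ∫ y in (0 : ℝ)..(x t).2, rate ν₀ y = X t (x t) := rfl
    rw [e3]
    simp only [slope, memCoeff, driftCoeff]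
    field_simp
    ring
  · filter_upwards with t ht
    have e1 := (D.η_pos t (hsub (Ioo_subset_Icc_self ht))).ne'
    have e2 := (S.h_pos t ⟨ha.trans ht.1, ht.2.le⟩).ne'
    field_simp
  · have e3 := residual_eq ν₀ c
    have : X T (x T) = residual ν₀ c := by
      simp only [hX, hxT]; linarith
    rw [this, mul_inv]
    ring

end IsFundamentalSystem

end LiquidationGame

/-! ### Stability, growth, sign and comparison of trajectories. -/

namespace LiquidationGame

variable {T δ : ℝ} {η κ lam h w u v : ℝ → ℝ} {ν₀ : Measure ℝ} [IsProbabilityMeasure ν₀] {a c : ℝ}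
  {m M g : ℝ → ℝ}

theorem IsFundamentalSystem.terminal_pos (S : IsFundamentalSystem T δ η κ lam h w u v)
    (D : IsMarket T δ η κ lam) : 0 < (h T)⁻¹ / η T :=
  div_pos (inv_pos.2 (S.h_pos T ⟨D.T_pos, le_rfl⟩)) (D.η_pos T (right_mem_Icc.2 D.T_pos.le))

namespace IsTrajectory

theorem m_eq_mul_inv (H : IsTrajectory T δ η κ lam h ν₀ a c m M g) (D : IsMarket T δ η κ lam)
    (S : IsFundamentalSystem T δ η κ lam h w u v) (ha : 0 < a) {t : ℝ} (ht : t ∈ Icc a T) :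
    m t = (η t * h t)⁻¹ * (level ν₀ c - massCoeff δ κ h w t * M t -
      ∫ x in (0 : ℝ)..g t, rate ν₀ x) := by
  have hc := H.conservation D S ha.le ht
  have e1 := (D.η_pos t ⟨ha.le.trans ht.1, ht.2⟩).ne'
  have e2 := (S.h_pos t ⟨ha.trans_le ht.1, ht.2⟩).ne'
  rw [← hc, massCoeff]
  field_simp
  ring

/-- By conservation `m` is a Lipschitz function of `(c, M, g)`, so Grönwall applies to `|M - M'| +
|g - g'|`. The choice `c = c'` gives uniqueness, general `c` gives continuous dependence; the
constant depends on `a`. -/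
theorem exists_stability (D : IsMarket T δ η κ lam)
    (S : IsFundamentalSystem T δ η κ lam h w u v) (ν₀ : Measure ℝ) [IsProbabilityMeasure ν₀]
    (ha : 0 < a) (haT : a ≤ T) :
    ∃ C, ∀ c c' m M g m' M' g', IsTrajectory T δ η κ lam h ν₀ a c m M g →
      IsTrajectory T δ η κ lam h ν₀ a c' m' M' g' →
      ∀ t ∈ Icc a T, |M t - M' t| + |g t - g' t| ≤ C * |c - c'| := by
  have hsub : Icc a T ⊆ Icc 0 T := Icc_subset_Icc_left ha.le
  have hQl := lipschitzWith_integral (antitone_rate ν₀) (abs_rate_le ν₀)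
  obtain ⟨C1, hC1, b1⟩ := IsMarket.exists_bound (S.continuousOn_inv_mul D ha)
  obtain ⟨C2, hC2, b2⟩ := IsMarket.exists_bound ((S.continuousOn_massCoeff D).mono hsub)
  obtain ⟨C3, hC3, b3⟩ := IsMarket.exists_bound
    ((D.continuousOn_κ.mul S.sol_h.fst.continuousOn).mono hsub)
  have hT := D.T_pos.le
  refine ⟨(1 + (1 + C3) * C1 * T) * Real.exp ((1 + C3) * C1 * (C2 + 2) * T), ?_⟩
  intro c c' m M g m' M' g' H H' t ht
  set d : ℝ → ℝ := fun s => |M s - M' s| + |g s - g' s| with hd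
  have hMc := H.deriv_M.sub H'.deriv_M
  have hgc := H.deriv_g.sub H'.deriv_g
  have dcont : ContinuousOn d (Icc a T) := hMc.continuousOn.abs.add hgc.continuousOn.abs
  set B : ℝ → ℝ := fun s => C1 * (|c - c'| + (C2 + 2) * d s) with hB
  have hm : ∀ s ∈ Icc a T, |m s - m' s| ≤ B s := fun s hs => by
    rw [H.m_eq_mul_inv D S ha hs, H'.m_eq_mul_inv D S ha hs, ← mul_sub, abs_mul]
    have e1 := b1 s hs
    have e2 := b2 s hs
    have e4 : |(∫ x in (0 : ℝ)..g s, rate ν₀ x) - ∫ x in (0 : ℝ)..g' s, rate ν₀ x| ≤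
        2 * |g s - g' s| := by
      have := hQl.dist_le_mul (g s) (g' s)
      simpa [Real.dist_eq] using this
    have e5 := abs_level_sub_le ν₀ c c'
    have e6 : |massCoeff δ κ h w s * (M s - M' s)| ≤ C2 * |M s - M' s| := by
      rw [abs_mul]; gcongr
    have e7 : |(level ν₀ c - massCoeff δ κ h w s * M s - ∫ x in (0 : ℝ)..g s, rate ν₀ x) -
        (level ν₀ c' - massCoeff δ κ h w s * M' s - ∫ x in (0 : ℝ)..g' s, rate ν₀ x)| ≤
        |c - c'| + (C2 + 2) * d s := by
      have : (level ν₀ c - massCoeff δ κ h w s * M s - ∫ x in (0 : ℝ)..g s, rate ν₀ x) -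
        (level ν₀ c' - massCoeff δ κ h w s * M' s - ∫ x in (0 : ℝ)..g' s, rate ν₀ x) =
        (level ν₀ c - level ν₀ c') - massCoeff δ κ h w s * (M s - M' s) -
        ((∫ x in (0 : ℝ)..g s, rate ν₀ x) - ∫ x in (0 : ℝ)..g' s, rate ν₀ x) := by ring
      rw [this]
      refine (abs_sub _ _).trans ((add_le_add (abs_sub _ _) le_rfl).trans ?_)
      have n1 := abs_nonneg (M s - M' s)
      have n2 := mul_nonneg hC2 (abs_nonneg (g s - g' s))
      simp only [hd]
      nlinarith
    exact mul_le_mul e1 e7 (abs_nonneg _) hC1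
  have dint : ∀ s ∈ Icc a T, IntervalIntegrable d volume s T := fun s hs => by
    apply ContinuousOn.intervalIntegrable
    rw [uIcc_of_le hs.2]
    exact dcont.mono (Icc_subset_Icc_left hs.1)
  have Bint : ∀ s ∈ Icc a T, IntervalIntegrable B volume s T := fun s hs =>
    ((intervalIntegrable_const.add ((dint s hs).const_mul _)).const_mul _)
  have Beq : ∀ s ∈ Icc a T, ∫ x in s..T, B x ≤
      C1 * (T * |c - c'|) + C1 * ((C2 + 2) * ∫ x in s..T, d x) := fun s hs => by
    simp only [hB]
    rw [intervalIntegral.integral_const_mul, intervalIntegral.integral_add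
      intervalIntegrable_const ((dint s hs).const_mul _), intervalIntegral.integral_const_mul,
      intervalIntegral.integral_const, smul_eq_mul, mul_add]
    gcongr
    linarith [hs.1]
  have key : ∀ s ∈ Icc a T, d s ≤ (1 + (1 + C3) * C1 * T) * |c - c'| +
      ((1 + C3) * C1 * (C2 + 2)) * ∫ x in s..T, d x := fun s hs => by
    have i1 := hMc.integral_eq_sub hs.1 hs.2 le_rfl
    have i2 := hgc.integral_eq_sub hs.1 hs.2 le_rfl
    rw [H.M_T, H'.M_T] at i1
    rw [H.g_T, H'.g_T] at i2
    have j1 : ‖∫ x in s..T, (-m x - -m' x)‖ ≤ ∫ x in s..T, B x := by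
      refine intervalIntegral.norm_integral_le_of_norm_le hs.2 ?_ (Bint s hs)
      filter_upwards with x hx
      have := hm x ⟨hs.1.trans hx.1.le, hx.2⟩
      rw [Real.norm_eq_abs, neg_sub_neg, abs_sub_comm]
      exact this
    have j2 : ‖∫ x in s..T, (κ x * h x * m x - κ x * h x * m' x)‖ ≤ ∫ x in s..T, C3 * B x := by
      refine intervalIntegral.norm_integral_le_of_norm_le hs.2 ?_ ((Bint s hs).const_mul _)
      filter_upwards with x hx
      have hx' : x ∈ Icc a T := ⟨hs.1.trans hx.1.le, hx.2⟩
      have e1 := hm x hx'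
      have e2 : |κ x * h x| ≤ C3 := b3 x hx'
      rw [← mul_sub, Real.norm_eq_abs, abs_mul]
      gcongr
    rw [i1, Real.norm_eq_abs] at j1
    rw [i2, Real.norm_eq_abs, intervalIntegral.integral_const_mul] at j2
    have k1 : |M s - M' s| ≤ ∫ x in s..T, B x := by
      rw [← abs_neg]; convert j1 using 2; ring
    have k2 : |g s - g' s| ≤ |c - c'| + C3 * ∫ x in s..T, B x := by
      have : g s - g' s = (c - c') - (c - c' - (g s - g' s)) := by ring
      rw [this]
      exact (abs_sub _ _).trans (by linarith)
    have k3 := mul_le_mul_of_nonneg_left (Beq s hs) (by positivity : 0 ≤ 1 + C3)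
    simp only [hd] at k3 ⊢
    linarith
  have hfin := le_mul_exp_of_le_integral haT (by positivity) dcont key ht
  refine hfin.trans ?_
  have : (1 + C3) * C1 * (C2 + 2) * (T - t) ≤ (1 + C3) * C1 * (C2 + 2) * T := by
    gcongr; linarith [ht.1]
  calc _ ≤ (1 + (1 + C3) * C1 * T) * |c - c'| * Real.exp ((1 + C3) * C1 * (C2 + 2) * T) := by
        gcongr
    _ = _ := by ring

theorem eqOn_of_pos {m' M' g' : ℝ → ℝ} (H : IsTrajectory T δ η κ lam h ν₀ a c m M g)
    (H' : IsTrajectory T δ η κ lam h ν₀ a c m' M' g') (D : IsMarket T δ η κ lam)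
    (S : IsFundamentalSystem T δ η κ lam h w u v) (ha : 0 < a) :
    EqOn m m' (Icc a T) ∧ EqOn M M' (Icc a T) ∧ EqOn g g' (Icc a T) := by
  obtain ⟨C, hC⟩ := exists_stability D S ν₀ ha H.deriv_m.le
  have h0 : ∀ t ∈ Icc a T, M t = M' t ∧ g t = g' t := fun t ht => by
    have := hC c c m M g m' M' g' H H' t ht
    rw [sub_self, abs_zero, mul_zero] at this
    have n1 := abs_nonneg (M t - M' t)
    have n2 := abs_nonneg (g t - g' t)
    exact ⟨sub_eq_zero.1 (abs_eq_zero.1 (by linarith)), sub_eq_zero.1 (abs_eq_zero.1 (by linarith))⟩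
  refine ⟨fun t ht => ?_, fun t ht => (h0 t ht).1, fun t ht => (h0 t ht).2⟩
  rw [H.m_eq_mul_inv D S ha ht, H'.m_eq_mul_inv D S ha ht, (h0 t ht).1, (h0 t ht).2]

theorem eqOn {m' M' g' : ℝ → ℝ} (H : IsTrajectory T δ η κ lam h ν₀ 0 c m M g)
    (H' : IsTrajectory T δ η κ lam h ν₀ 0 c m' M' g') (D : IsMarket T δ η κ lam)
    (S : IsFundamentalSystem T δ η κ lam h w u v) : EqOn m m' (Icc 0 T) := by
  have h1 : EqOn m m' (Ioc 0 T) := fun t ht =>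
    ((H.mono ht.1.le ht.2).eqOn_of_pos (H'.mono ht.1.le ht.2) D S ht.1).1 ⟨le_rfl, ht.2⟩
  refine h1.of_subset_closure H.deriv_m.continuousOn H'.deriv_m.continuousOn Ioc_subset_Icc_self ?_
  rw [closure_Ioc D.T_pos.ne]

/-- Grönwall on the original equation, in which `1 / h` does not occur, so the bound survives `a →
0`. It needs only boundedness of the rate. -/
theorem exists_growth (D : IsMarket T δ η κ lam)
    (S : IsFundamentalSystem T δ η κ lam h w u v) (ν₀ : Measure ℝ) [IsProbabilityMeasure ν₀] :
    ∃ B, 0 ≤ B ∧ ∀ a c m M g, 0 ≤ a → IsTrajectory T δ η κ lam h ν₀ a c m M g →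
      ∀ t ∈ Icc a T, |m t| ≤ B * |residual ν₀ c| := by
  obtain ⟨C1, hC1, b1⟩ := IsMarket.exists_bound D.continuousOn_κ_div_η
  obtain ⟨C2, hC2, b2⟩ := D.exists_bound_memCoeff
  obtain ⟨C3, hC3, b3⟩ := IsMarket.exists_bound D.continuousOn_driftCoeff
  have hT := D.T_pos.le
  have hp := S.terminal_pos D
  set K := C1 * 2 + C3 + C2 * T with hK
  have hK0 : 0 ≤ K := by positivity
  refine ⟨(h T)⁻¹ / η T * Real.exp (K * T), by positivity, ?_⟩
  intro a c m M g ha H t ht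
  have haT := H.deriv_m.le
  have mint : ∀ s ∈ Icc a T, IntervalIntegrable (fun x => |m x|) volume s T := fun s hs => by
    apply ContinuousOn.intervalIntegrable
    rw [uIcc_of_le hs.2]
    exact H.deriv_m.continuousOn.abs.mono (Icc_subset_Icc_left hs.1)
  have key : ∀ s ∈ Icc a T, |m s| ≤ (h T)⁻¹ / η T * |residual ν₀ c| + K * ∫ x in s..T, |m x| :=
    fun s hs => by
    set N := ∫ x in s..T, |m x| with hN
    have hN0 : 0 ≤ N := intervalIntegral.integral_nonneg hs.2 fun x _ => abs_nonneg _
    have hMN : ∀ x ∈ Icc s T, |M x| ≤ N := fun x hx => by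
      rw [H.M_eq ⟨hs.1.trans hx.1, hx.2⟩]
      refine (intervalIntegral.abs_integral_le_integral_abs hx.2).trans ?_
      exact intervalIntegral.integral_mono_interval hx.1 hx.2 le_rfl
        (Eventually.of_forall fun x => abs_nonneg _) (mint s hs)
    have j1 : ‖∫ x in s..T, slope T δ η κ lam ν₀ x (m x) (M x) (g x)‖ ≤
        ∫ x in s..T, ((C1 * 2 + C3) * |m x| + C2 * N) := by
      refine intervalIntegral.norm_integral_le_of_norm_le hs.2 ?_
        (((mint s hs).const_mul _).add intervalIntegrable_const)
      filter_upwards [b2] with x hx2 hx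
      have hx' : x ∈ Icc 0 T := ⟨ha.trans (hs.1.trans hx.1.le), hx.2⟩
      have e1 := b1 x hx'
      obtain ⟨e2, e2'⟩ := hx2 hx'
      have e3 := b3 x hx'
      have e4 : |rate ν₀ (g x)| ≤ 2 := abs_rate_le ν₀ (g x)
      have e5 := hMN x ⟨hx.1.le, hx.2⟩
      rw [Real.norm_eq_abs, slope]
      refine (abs_add_le _ _).trans ((add_le_add (abs_add_le _ _) le_rfl).trans ?_)
      rw [abs_mul (κ x / η x * rate ν₀ (g x)), abs_mul (κ x / η x), abs_mul (memCoeff _ _ _ _ _ _),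
        abs_mul (driftCoeff _ _ _ _ _), abs_of_nonneg e2]
      have f1 : |κ x / η x| * |rate ν₀ (g x)| * |m x| ≤ C1 * 2 * |m x| := by gcongr
      have f2 : memCoeff T δ η κ lam x * |M x| ≤ C2 * N := by gcongr
      have f3 : |driftCoeff T δ η κ x| * |m x| ≤ C3 * |m x| := by gcongr
      linarith
    rw [intervalIntegral.integral_add ((mint s hs).const_mul _) intervalIntegrable_const,
      intervalIntegral.integral_const_mul, intervalIntegral.integral_const, smul_eq_mul, ← hN,
      Real.norm_eq_abs] at j1
    rw [H.m_eq hs]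
    refine (abs_add_le _ _).trans ?_
    rw [abs_mul, abs_of_pos hp]
    have : (T - s) * (C2 * N) ≤ T * (C2 * N) := by
      gcongr; linarith [hs.1]
    rw [hK]
    linarith
  refine (le_mul_exp_of_le_integral haT hK0 H.deriv_m.continuousOn.abs key ht).trans ?_
  have : K * (T - t) ≤ K * T := by
    gcongr; linarith [ht.1]
  calc _ ≤ (h T)⁻¹ / η T * |residual ν₀ c| * Real.exp (K * T) := by gcongr
    _ = _ := by ring

/-- `slope` is linear in `(m, M)`; its value at `m = 1`, `M = 0` is the local coefficient `α` of the
Volterra equation. -/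
theorem intervalIntegrable_rateCoeff (H : IsTrajectory T δ η κ lam h ν₀ a c m M g)
    (D : IsMarket T δ η κ lam) (ha : 0 ≤ a) :
    IntervalIntegrable (fun s => slope T δ η κ lam ν₀ s 1 0 (g s)) volume a T :=
  D.intervalIntegrable_slope (m := fun _ => 1) (M := fun _ => 0) ha H.deriv_m.le
    intervalIntegrable_const continuousOn_const H.deriv_g.continuousOn

theorem nonneg (H : IsTrajectory T δ η κ lam h ν₀ a c m M g) (D : IsMarket T δ η κ lam)
    (S : IsFundamentalSystem T δ η κ lam h w u v) (ha : 0 ≤ a) (hc : 0 ≤ residual ν₀ c) {t : ℝ}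
    (ht : t ∈ Icc a T) : 0 ≤ m t ∧ (0 < residual ν₀ c → 0 < m t) := by
  obtain ⟨C, -, hC⟩ := D.exists_bound_memCoeff
  have hp := S.terminal_pos D
  have := nonneg_of_backward_volterra (β := memCoeff T δ η κ lam) (r := fun _ => 0) (H.deriv_m.congr_deriv (by
    filter_upwards with s _
    simp only [slope]; ring)) H.deriv_M H.M_T (H.intervalIntegrable_rateCoeff D ha)
    (by filter_upwards [hC] with s hs hsm using hs ⟨ha.trans hsm.1.le, hsm.2.le⟩)
    (by filter_upwards with s _ using le_rfl) (by rw [H.m_T]; positivity) ht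
  refine ⟨this.1, fun hpos => ?_⟩
  have h2 := this.2
  rw [H.m_T] at h2
  exact pos_of_mul_pos_left ((mul_pos hp hpos).trans_le h2) (Real.exp_pos _).le

theorem nonpos (H : IsTrajectory T δ η κ lam h ν₀ a c m M g) (D : IsMarket T δ η κ lam)
    (S : IsFundamentalSystem T δ η κ lam h w u v) (ha : 0 ≤ a) (hc : residual ν₀ c ≤ 0) {t : ℝ}
    (ht : t ∈ Icc a T) : m t ≤ 0 := by
  obtain ⟨C, -, hC⟩ := D.exists_bound_memCoeff
  have hp := S.terminal_pos D
  have := nonneg_of_backward_volterra (β := memCoeff T δ η κ lam) (r := fun _ => 0) (H.deriv_m.neg.congr_deriv (by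
    filter_upwards with s _
    simp only [slope]; ring)) H.deriv_M.neg (by rw [H.M_T, neg_zero])
    (H.intervalIntegrable_rateCoeff D ha)
    (by filter_upwards [hC] with s hs hsm using hs ⟨ha.trans hsm.1.le, hsm.2.le⟩)
    (by filter_upwards with s _ using le_rfl)
    (by rw [H.m_T]; exact neg_nonneg.2 (mul_nonpos_of_nonneg_of_nonpos hp.le hc)) ht
  linarith [this.1]

variable {c₁ c₂ : ℝ} {m₁ M₁ g₁ m₂ M₂ g₂ : ℝ → ℝ}

/-- While `g₁ ≤ g₂`, the difference `m₁ - m₂` solves a Volterra equation whose source `(κ / η)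
(ρ(g₁) - ρ(g₂)) m₁` and terminal value are nonnegative. So `m₁ ≥ m₂`, and `g₂ - g₁` is nonincreasing
in time. -/
theorem sub_le_sub_of_le (H₁ : IsTrajectory T δ η κ lam h ν₀ a c₁ m₁ M₁ g₁)
    (H₂ : IsTrajectory T δ η κ lam h ν₀ a c₂ m₂ M₂ g₂) (D : IsMarket T δ η κ lam)
    (S : IsFundamentalSystem T δ η κ lam h w u v) (ha : 0 ≤ a) (hc : c₁ ≤ c₂)
    (hres : 0 ≤ residual ν₀ c₁) (hg : ∀ t ∈ Ioo a T, g₁ t ≤ g₂ t) :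
    c₂ - c₁ ≤ g₂ a - g₁ a := by
  obtain ⟨C, -, hC⟩ := D.exists_bound_memCoeff
  have hp := S.terminal_pos D
  have haT := H₁.deriv_m.le
  have hφ : ∀ t ∈ Icc a T, 0 ≤ m₁ t - m₂ t := fun t ht =>
    (nonneg_of_backward_volterra
      (β := memCoeff T δ η κ lam)
      (r := fun s => κ s / η s * ((rate ν₀ (g₁ s) - rate ν₀ (g₂ s)) * m₁ s))
      ((H₁.deriv_m.sub H₂.deriv_m).congr_deriv (by
        filter_upwards with s _
        simp only [slope]; ring))
      ((H₁.deriv_M.sub H₂.deriv_M).congr_deriv (by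
        filter_upwards with s _
        ring)) (by rw [H₁.M_T, H₂.M_T, sub_zero])
      (H₂.intervalIntegrable_rateCoeff D ha)
      (by filter_upwards [hC] with s hs hsm using hs ⟨ha.trans hsm.1.le, hsm.2.le⟩)
      (by
        filter_upwards with s hs
        have hs' : s ∈ Icc 0 T := ⟨ha.trans hs.1.le, hs.2.le⟩
        exact mul_nonneg (div_nonneg (D.κ_nonneg s hs') (D.η_pos s hs').le)
          (mul_nonneg (sub_nonneg.2 (antitone_rate ν₀ (hg s hs)))
            (H₁.nonneg D S ha hres (Ioo_subset_Icc_self hs)).1))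
      (by
        rw [H₁.m_T, H₂.m_T, ← mul_sub]
        exact mul_nonneg hp.le (sub_nonneg.2 (antitone_residual ν₀ hc))) ht).1
  have h1 := (H₁.deriv_g.sub H₂.deriv_g).le_of_ae_nonneg (by
    filter_upwards with s hs
    have hs' : s ∈ Ioc 0 T := ⟨ha.trans_lt hs.1, hs.2.le⟩
    rw [← mul_sub]
    exact mul_nonneg (mul_nonneg (D.κ_nonneg s (Ioc_subset_Icc_self hs')) (S.h_pos s hs').le)
      (hφ s (Ioo_subset_Icc_self hs))) le_rfl haT le_rfl
  rw [H₁.g_T, H₂.g_T] at h1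
  linarith

/-- Comparison principle: the initial value of `g` increases at least as fast as its terminal
value. -/
theorem sub_le_sub (H₁ : IsTrajectory T δ η κ lam h ν₀ 0 c₁ m₁ M₁ g₁)
    (H₂ : IsTrajectory T δ η κ lam h ν₀ 0 c₂ m₂ M₂ g₂) (D : IsMarket T δ η κ lam)
    (S : IsFundamentalSystem T δ η κ lam h w u v) (hc : c₁ < c₂) (hres : 0 ≤ residual ν₀ c₁) :
    c₂ - c₁ ≤ g₂ 0 - g₁ 0 := by
  set Z := Icc 0 T ∩ (fun t => g₂ t - g₁ t) ⁻¹' Iic 0 with hZ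
  rcases Z.eq_empty_or_nonempty with hE | hne
  · refine H₁.sub_le_sub_of_le H₂ D S le_rfl hc.le hres fun t ht => ?_
    by_contra hcon
    have : t ∈ Z := ⟨Ioo_subset_Icc_self ht, by
      change g₂ t - g₁ t ≤ 0
      linarith [not_le.1 hcon]⟩
    rw [hE] at this
    exact this
  · exfalso
    have hcl : IsClosed Z := (H₂.deriv_g.sub H₁.deriv_g).continuousOn.preimage_isClosed_of_isClosed
      isClosed_Icc isClosed_Iic
    have hbdd : BddAbove Z := ⟨T, fun x hx => hx.1.2⟩
    -- After the last time `t₁` with `g₂ ≤ g₁` the paths are ordered, so the gap at `t₁` would be at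
    -- least `c₂ - c₁ > 0`.
    have h1 := hcl.csSup_mem hne hbdd
    set t₁ := sSup Z
    have h2 : g₂ t₁ - g₁ t₁ ≤ 0 := h1.2
    have h3 := (H₁.mono h1.1.1 h1.1.2).sub_le_sub_of_le (H₂.mono h1.1.1 h1.1.2) D S h1.1.1 hc.le
      hres fun t ht => by
        by_contra hcon
        have : t ∈ Z := ⟨⟨h1.1.1.trans ht.1.le, ht.2.le⟩, by
          change g₂ t - g₁ t ≤ 0
          linarith [not_le.1 hcon]⟩
        exact (le_csSup hbdd this).not_gt ht.1
    linarith

end IsTrajectory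

/-! ### Existence up to time `0`. -/

/-- Existence on the whole interval: the solutions on `[a, T]`, `a > 0`, are bounded uniformly in
`a`, and the integral equation extends them to `0`. -/
theorem IsFundamentalSystem.exists_trajectory (S : IsFundamentalSystem T δ η κ lam h w u v)
    (D : IsMarket T δ η κ lam) (ν₀ : Measure ℝ) [IsProbabilityMeasure ν₀] (c : ℝ) :
    ∃ m M g, IsTrajectory T δ η κ lam h ν₀ 0 c m M g := by
  have hT := D.T_pos.le
  have hex : ∀ a : ℝ, ∃ m M g, a ∈ Ioc 0 T → IsTrajectory T δ η κ lam h ν₀ a c m M g := fun a => by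
    by_cases ha : a ∈ Ioc 0 T
    · obtain ⟨m, M, g, H⟩ := S.exists_trajectory_of_pos D ν₀ ha.1 ha.2 c
      exact ⟨m, M, g, fun _ => H⟩
    · exact ⟨0, 0, 0, fun hh => absurd hh ha⟩
  choose p P q Hp using hex
  -- By uniqueness on `[a, T]` the diagonal agrees with every `p a`; its value at `0` is arbitrary.
  set m : ℝ → ℝ := fun t => p t t with hm
  have hmp : ∀ a ∈ Ioc 0 T, EqOn m (p a) (Icc a T) := fun a ha t ht => by
    have ht' : t ∈ Ioc 0 T := ⟨ha.1.trans_le ht.1, ht.2⟩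
    exact ((Hp t ht').eqOn_of_pos ((Hp a ha).mono ht.1 ht.2) D S ht'.1).1 ⟨le_rfl, ht.2⟩
  obtain ⟨B, hB0, hB⟩ := IsTrajectory.exists_growth D S ν₀
  have hbd : ∀ t ∈ Ioc 0 T, |m t| ≤ B * |residual ν₀ c| := fun t ht =>
    hB t c (p t) (P t) (q t) ht.1.le (Hp t ht) t ⟨le_rfl, ht.2⟩
  have hcont : ContinuousOn m (Ioc 0 T) := fun t ht => by
    have ha : t / 2 ∈ Ioc 0 T := ⟨half_pos ht.1, (half_le_self ht.1.le).trans ht.2⟩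
    have h1 : ContinuousOn m (Icc (t / 2) T) :=
      (Hp _ ha).deriv_m.continuousOn.congr (hmp _ ha)
    refine (h1 t ⟨half_le_self ht.1.le, ht.2⟩).mono_of_mem_nhdsWithin ?_
    filter_upwards [self_mem_nhdsWithin, mem_nhdsWithin_of_mem_nhds
      (Ioi_mem_nhds (half_lt_self ht.1))] with x hx hx2 using ⟨le_of_lt hx2, hx.2⟩
  have hint : IntervalIntegrable m volume 0 T := by
    rw [intervalIntegrable_iff_integrableOn_Ioc_of_le hT]
    refine IntegrableOn.of_bound (by simp) (hcont.aestronglyMeasurable measurableSet_Ioc)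
      (B * |residual ν₀ c|) ?_
    exact (ae_restrict_iff' measurableSet_Ioc).2 (Eventually.of_forall hbd)
  -- The right-hand side of the equation agrees with `m` on `(0, T]` and supplies the correct value
  -- at `0`.
  set m' : ℝ → ℝ := fun t => (h T)⁻¹ / η T * residual ν₀ c +
      ∫ s in t..T, slope T δ η κ lam ν₀ s (m s) (∫ r in s..T, m r)
        (c - ∫ r in s..T, κ r * h r * m r) with hm'
  have hmm : EqOn m m' (Ioc 0 T) := fun t ht => by
    have htt : t ∈ Icc t T := ⟨le_rfl, ht.2⟩
    rw [hm', hmp t ht htt, (Hp t ht).m_eq htt]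
    congr 1
    refine intervalIntegral.integral_congr fun s hs => ?_
    rw [uIcc_of_le ht.2] at hs
    have hr : ∀ f : ℝ → ℝ → ℝ, ∫ r in s..T, f r (p t r) = ∫ r in s..T, f r (m r) := fun f => by
      refine intervalIntegral.integral_congr fun r hr => ?_
      rw [uIcc_of_le hs.2] at hr
      exact congrArg (f r) (hmp t ht ⟨hs.1.trans hr.1, hr.2⟩).symm
    rw [(Hp t ht).M_eq hs, (Hp t ht).g_eq hs, hmp t ht hs, hr fun _ y => y,
      hr fun r y => κ r * h r * y]
  have hint' : ∀ t ∈ Icc 0 T, ∀ f : ℝ → ℝ → ℝ, ∫ s in t..T, f s (m s) = ∫ s in t..T, f s (m' s) :=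
    fun t ht f => by
      refine intervalIntegral.integral_congr_ae (Eventually.of_forall fun s hs => ?_)
      rw [uIoc_of_le ht.2] at hs
      rw [hmm ⟨ht.1.trans_lt hs.1, hs.2⟩]
  refine ⟨m', _, _, IsTrajectory.of_integral D le_rfl hT S.sol_h.fst.continuousOn ?_ fun t ht => ?_⟩
  · refine hint.congr fun s hs => ?_
    rw [uIoc_of_le hT] at hs
    exact hmm hs
  · change (h T)⁻¹ / η T * residual ν₀ c +
      ∫ s in t..T, slope T δ η κ lam ν₀ s (m s) (∫ r in s..T, m r)
        (c - ∫ r in s..T, κ r * h r * m r) = _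
    congr 1
    refine intervalIntegral.integral_congr_ae (Eventually.of_forall fun s hs => ?_)
    rw [uIoc_of_le ht.2] at hs
    have hs' : s ∈ Icc 0 T := ⟨ht.1.trans hs.1.le, hs.2⟩
    rw [hmm ⟨ht.1.trans_lt hs.1, hs.2⟩, hint' s hs' fun _ y => y,
      hint' s hs' fun r y => κ r * h r * y]

end LiquidationGame

/-! ### Equivalence of trajectories with the integral equations (1) and (2). -/

namespace LiquidationGame

variable {T δ : ℝ} {η κ lam h w u v : ℝ → ℝ} {ν₀ : Measure ℝ} {c : ℝ} {m M g : ℝ → ℝ}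

namespace IsFundamentalSystem

theorem integral_hFun_eq (S : IsFundamentalSystem T δ η κ lam h w u v)
    (D : IsMarket T δ η κ lam) (m : ℝ → ℝ) {s t : ℝ} (hs : s ∈ Icc 0 T) (ht : t ∈ Icc 0 T) :
    ∫ r in s..t, κ r * hFun T δ η κ lam r * m r = ∫ r in s..t, κ r * h r * m r := by
  have hne : ∀ᵐ r : ℝ, r ≠ T := by simp [ae_iff, measure_singleton]
  refine intervalIntegral.integral_congr_ae ?_
  filter_upwards [hne] with r hrT hr
  have hr' := uIcc_subset_Icc hs ht (uIoc_subset_uIcc hr)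
  rw [S.hFun_eq D ⟨hr'.1, lt_of_le_of_ne hr'.2 hrT⟩]

theorem terminalValue_eq (S : IsFundamentalSystem T δ η κ lam h w u v)
    (D : IsMarket T δ η κ lam) (ν₀ : Measure ℝ) (c : ℝ) :
    terminalValue T δ η κ lam ν₀ c = (h T)⁻¹ / η T * residual ν₀ c := by
  rw [terminalValue, S.alphaT_eq D]; rfl

theorem intervalIntegrable_mul (S : IsFundamentalSystem T δ η κ lam h w u v)
    (D : IsMarket T δ η κ lam) (hm : IntervalIntegrable m volume 0 T) :
    IntervalIntegrable (fun r => κ r * h r * m r) volume 0 T := by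
  have h1 := D.continuousOn_κ.mul S.sol_h.fst.continuousOn
  rw [← uIcc_of_le D.T_pos.le] at h1
  exact hm.continuousOn_mul h1

variable [IsProbabilityMeasure ν₀]

/-- The free function `G` serves both equations: in (1) the rate is evaluated at `c` minus a tail
integral, in (2) at `f_μ`. -/
theorem integral_slope_eq (S : IsFundamentalSystem T δ η κ lam h w u v)
    (D : IsMarket T δ η κ lam) (hm : IntervalIntegrable m volume 0 T) {G : ℝ → ℝ}
    (hG : ∀ s ∈ Icc 0 T, G s = c - ∫ r in s..T, κ r * h r * m r) {t : ℝ} (ht : t ∈ Icc 0 T) :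
    ∫ s in t..T, slope T δ η κ lam ν₀ s (m s) (∫ r in s..T, m r)
        (c - ∫ r in s..T, κ r * h r * m r) =
      (∫ s in t..T, κ s / η s * (qTail ν₀ (G s) + pTail ν₀ 0) * m s)
      + (∫ s in t..T, (lam s + δ * derivWithin κ (Icc 0 T) s) / η s * ∫ u in s..T, m u)
      + ∫ s in t..T, (derivWithin η (Icc 0 T) s - δ * κ s) / η s * m s := by
  have hT := D.T_pos.le
  have hM := (HasACDerivOn.integral_left hT hm).continuousOn
  have hg := (HasACDerivOn.integral_left hT (S.intervalIntegrable_mul D hm)).continuousOn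
  have hsub : uIcc t T ⊆ uIcc 0 T := by
    rw [uIcc_of_le ht.2, uIcc_of_le hT]; exact Icc_subset_Icc_left ht.1
  have i0 := (D.intervalIntegrable_slope (ν₀ := ν₀)
    (g := fun s => c - ∫ r in s..T, κ r * h r * m r) le_rfl hT hm hM
    (continuousOn_const (c := c).sub hg)).mono_set hsub
  have i2 : IntervalIntegrable (fun s => memCoeff T δ η κ lam s * ∫ r in s..T, m r) volume t T := by
    rw [← uIcc_of_le hT] at hM
    exact (D.intervalIntegrable_memCoeff.mul_continuousOn hM).mono_set hsub
  have i3 : IntervalIntegrable (fun s => driftCoeff T δ η κ s * m s) volume t T := by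
    have h1 := D.continuousOn_driftCoeff
    rw [← uIcc_of_le hT] at h1
    exact (hm.continuousOn_mul h1).mono_set hsub
  have i1 : IntervalIntegrable (fun s => κ s / η s * rate ν₀ (c - ∫ r in s..T, κ r * h r * m r) *
      m s) volume t T := by
    refine ((i0.sub i2).sub i3).congr fun s _ => ?_
    simp only [slope]
    ring
  have e1 : ∫ s in t..T, κ s / η s * (qTail ν₀ (G s) + pTail ν₀ 0) * m s =
      ∫ s in t..T, κ s / η s * rate ν₀ (c - ∫ r in s..T, κ r * h r * m r) * m s := by
    refine intervalIntegral.integral_congr fun s hs => ?_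
    rw [uIcc_of_le ht.2] at hs
    simp only [hG s ⟨ht.1.trans hs.1, hs.2⟩]
    rfl
  rw [e1]
  change _ = _ + (∫ s in t..T, memCoeff T δ η κ lam s * ∫ u in s..T, m u) +
    ∫ s in t..T, driftCoeff T δ η κ s * m s
  rw [← intervalIntegral.integral_add i1 i2, ← intervalIntegral.integral_add (i1.add i2) i3]
  rfl

theorem sub_integral_eq (S : IsFundamentalSystem T δ η κ lam h w u v)
    (D : IsMarket T δ η κ lam) (hm : IntervalIntegrable m volume 0 T) {s : ℝ} (hs : s ∈ Icc 0 T) :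
    fFun T δ η κ lam m s = fFun T δ η κ lam m T - ∫ r in s..T, κ r * h r * m r := by
  have h0 : (0 : ℝ) ∈ Icc 0 T := left_mem_Icc.2 D.T_pos.le
  have hT : T ∈ Icc 0 T := right_mem_Icc.2 D.T_pos.le
  have hi := S.intervalIntegrable_mul D hm
  rw [fFun, fFun, S.integral_hFun_eq D m h0 hs, S.integral_hFun_eq D m h0 hT, eq_sub_iff_add_eq]
  refine intervalIntegral.integral_add_adjacent_intervals (hi.mono_set ?_) (hi.mono_set ?_)
  · rw [uIcc_of_le D.T_pos.le]; exact uIcc_subset_Icc h0 hs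
  · rw [uIcc_of_le D.T_pos.le]; exact uIcc_subset_Icc hs hT

theorem isTrajectory_of_isBackwardSolution (S : IsFundamentalSystem T δ η κ lam h w u v)
    (D : IsMarket T δ η κ lam) (H : IsBackwardSolution T δ η κ lam ν₀ c m) :
    IsTrajectory T δ η κ lam h ν₀ 0 c m (fun t => ∫ s in t..T, m s)
      (fun t => c - ∫ s in t..T, κ s * h s * m s) := by
  have hT := D.T_pos.le
  have hm : IntervalIntegrable m volume 0 T := by
    apply ContinuousOn.intervalIntegrable
    rw [uIcc_of_le hT]; exact H.1
  refine IsTrajectory.of_integral D le_rfl hT S.sol_h.fst.continuousOn hm fun t ht => ?_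
  rw [S.integral_slope_eq D hm (G := fun s => c - ∫ r in s..T, κ r * hFun T δ η κ lam r * m r)
    (fun s hs => by rw [S.integral_hFun_eq D m hs (right_mem_Icc.2 hT)]) ht,
    ← S.terminalValue_eq D, ← add_assoc, ← add_assoc]
  exact H.2 t ht

theorem isBackwardSolution_of_isTrajectory (S : IsFundamentalSystem T δ η κ lam h w u v)
    (D : IsMarket T δ η κ lam) (H : IsTrajectory T δ η κ lam h ν₀ 0 c m M g) :
    IsBackwardSolution T δ η κ lam ν₀ c m := by
  have hT := D.T_pos.le
  have hm : IntervalIntegrable m volume 0 T := by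
    apply ContinuousOn.intervalIntegrable
    rw [uIcc_of_le hT]; exact H.deriv_m.continuousOn
  refine ⟨H.deriv_m.continuousOn, fun t ht => ?_⟩
  rw [add_assoc, add_assoc, ← add_assoc (∫ s in t..T, _), ← S.integral_slope_eq D hm
    (G := fun s => c - ∫ r in s..T, κ r * hFun T δ η κ lam r * m r)
    (fun s hs => by rw [S.integral_hFun_eq D m hs (right_mem_Icc.2 hT)]) ht,
    S.terminalValue_eq D, H.m_eq ht]
  congr 1
  refine intervalIntegral.integral_congr fun s hs => ?_
  rw [uIcc_of_le ht.2] at hs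
  simp only [H.M_eq ⟨ht.1.trans hs.1, hs.2⟩, H.g_eq ⟨ht.1.trans hs.1, hs.2⟩]

/-- Regularity is gained here: an integrable solution of (2) equals an integral of integrable terms,
hence is continuous. -/
theorem isBackwardSolution_of_isEquilibriumSolution (S : IsFundamentalSystem T δ η κ lam h w u v)
    (D : IsMarket T δ η κ lam) (H : IsEquilibriumSolution T δ η κ lam ν₀ m) :
    IsBackwardSolution T δ η κ lam ν₀ (fFun T δ η κ lam m T) m := by
  have hT := D.T_pos.le
  have hm : IntervalIntegrable m volume 0 T := by
    rw [intervalIntegrable_iff_integrableOn_Icc_of_le hT]; exact H.1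
  refine S.isBackwardSolution_of_isTrajectory D
    (IsTrajectory.of_integral D le_rfl hT S.sol_h.fst.continuousOn hm fun t ht => ?_)
  rw [S.integral_slope_eq D hm (fun s hs => S.sub_integral_eq D hm hs) ht,
    ← S.terminalValue_eq D, ← H.2.2, ← add_assoc, ← add_assoc]
  exact H.2.1 t ht

theorem isEquilibriumSolution_of_isBackwardSolution (S : IsFundamentalSystem T δ η κ lam h w u v)
    (D : IsMarket T δ η κ lam) (H : IsBackwardSolution T δ η κ lam ν₀ c m)
    (hc : fFun T δ η κ lam m T = c) : IsEquilibriumSolution T δ η κ lam ν₀ m := by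
  have hT := D.T_pos.le
  have hmT : m T = terminalValue T δ η κ lam ν₀ c := by
    simpa using H.2 T (right_mem_Icc.2 hT)
  have hm : IntervalIntegrable m volume 0 T := by
    apply ContinuousOn.intervalIntegrable
    rw [uIcc_of_le hT]; exact H.1
  refine ⟨H.1.integrableOn_Icc, fun t ht => ?_, by rw [hc, hmT]⟩
  have e1 := H.2 t ht
  rw [add_assoc, add_assoc, ← add_assoc (∫ s in t..T, _), ← S.integral_slope_eq D hm
    (G := fun s => c - ∫ r in s..T, κ r * hFun T δ η κ lam r * m r)
    (fun s hs => by rw [S.integral_hFun_eq D m hs (right_mem_Icc.2 hT)]) ht,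
    S.integral_slope_eq D hm (G := fFun T δ η κ lam m)
      (fun s hs => by rw [S.sub_integral_eq D hm hs, hc]) ht, ← hmT, ← add_assoc, ← add_assoc] at e1
  exact e1

end IsFundamentalSystem

/-! ### The fixed point `f_μ(T) = c` as a root of `c ↦ g_0`. -/

section FixedPoint

theorem IsTrajectory.g_zero (H : IsTrajectory T δ η κ lam h ν₀ 0 c m M g)
    (S : IsFundamentalSystem T δ η κ lam h w u v) (D : IsMarket T δ η κ lam) :
    g 0 = c - fFun T δ η κ lam m T := by
  have h0 : (0 : ℝ) ∈ Icc 0 T := left_mem_Icc.2 D.T_pos.le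
  rw [H.g_eq h0, fFun, S.integral_hFun_eq D m h0 (right_mem_Icc.2 D.T_pos.le)]

variable [IsProbabilityMeasure ν₀]

theorem IsTrajectory.fFun_nonneg (H : IsTrajectory T δ η κ lam h ν₀ 0 c m M g)
    (S : IsFundamentalSystem T δ η κ lam h w u v) (D : IsMarket T δ η κ lam)
    (hc : 0 ≤ residual ν₀ c) : 0 ≤ fFun T δ η κ lam m T := by
  have h0 : (0 : ℝ) ∈ Icc 0 T := left_mem_Icc.2 D.T_pos.le
  rw [fFun, S.integral_hFun_eq D m h0 (right_mem_Icc.2 D.T_pos.le)]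
  refine intervalIntegral.integral_nonneg D.T_pos.le fun t ht => ?_
  have hh : 0 ≤ h t := by
    rcases ht.1.eq_or_lt with rfl | h1
    · rw [S.h_zero]
    · exact (S.h_pos t ⟨h1, ht.2⟩).le
  exact mul_nonneg (mul_nonneg (D.κ_nonneg t ht) hh) (H.nonneg D S le_rfl hc ht).1

theorem IsTrajectory.fFun_nonpos (H : IsTrajectory T δ η κ lam h ν₀ 0 c m M g)
    (S : IsFundamentalSystem T δ η κ lam h w u v) (D : IsMarket T δ η κ lam)
    (hc : residual ν₀ c ≤ 0) : fFun T δ η κ lam m T ≤ 0 := by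
  have h0 : (0 : ℝ) ∈ Icc 0 T := left_mem_Icc.2 D.T_pos.le
  rw [fFun, S.integral_hFun_eq D m h0 (right_mem_Icc.2 D.T_pos.le), ← neg_nonneg,
    ← intervalIntegral.integral_neg]
  refine intervalIntegral.integral_nonneg D.T_pos.le fun t ht => ?_
  have hh : 0 ≤ h t := by
    rcases ht.1.eq_or_lt with rfl | h1
    · rw [S.h_zero]
    · exact (S.h_pos t ⟨h1, ht.2⟩).le
  exact neg_nonneg.2 (mul_nonpos_of_nonneg_of_nonpos (mul_nonneg (D.κ_nonneg t ht) hh)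
    (H.nonpos D S le_rfl hc ht))

theorem IsTrajectory.fFun_pos (H : IsTrajectory T δ η κ lam h ν₀ 0 c m M g)
    (S : IsFundamentalSystem T δ η κ lam h w u v) (D : IsMarket T δ η κ lam)
    (hc : 0 < residual ν₀ c) (hκ : ∃ t ∈ Icc 0 T, κ t ≠ 0) : 0 < fFun T δ η κ lam m T := by
  have h0 : (0 : ℝ) ∈ Icc 0 T := left_mem_Icc.2 D.T_pos.le
  rw [fFun, S.integral_hFun_eq D m h0 (right_mem_Icc.2 D.T_pos.le)]
  refine intervalIntegral.integral_pos D.T_pos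
    ((D.continuousOn_κ.mul S.sol_h.fst.continuousOn).mul H.deriv_m.continuousOn)
    (fun t ht => ?_) ?_
  · have ht' := Ioc_subset_Icc_self ht
    exact mul_nonneg (mul_nonneg (D.κ_nonneg t ht') (S.h_pos t ht).le)
      (H.nonneg D S le_rfl hc.le ht').1
  -- A point with `κ ≠ 0` must be found away from `0`, where `h` vanishes; continuity of `κ`
  -- provides it.
  · obtain ⟨t, ht, hκt⟩ : ∃ t ∈ Ioc 0 T, κ t ≠ 0 := by
      by_contra! hcon
      obtain ⟨t, ht, hκt⟩ := hκ
      have h1 : EqOn κ 0 (Icc 0 T) := by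
        refine EqOn.of_subset_closure (s := Ioc 0 T) hcon D.continuousOn_κ continuousOn_const
          Ioc_subset_Icc_self ?_
        rw [closure_Ioc D.T_pos.ne]
      exact hκt (h1 ht)
    have ht' := Ioc_subset_Icc_self ht
    exact ⟨t, ht', mul_pos (mul_pos ((D.κ_nonneg t ht').lt_of_ne' hκt) (S.h_pos t ht))
      ((H.nonneg D S le_rfl hc.le ht').2 hc)⟩

variable {p P q : ℝ → ℝ → ℝ}

/-- Stability is available only on `[a, T]` with `a > 0`. The growth bound makes `q c a` close to `q
c 0` uniformly for `c` in `[0, X]`, so `c ↦ q c 0` is a uniform limit of Lipschitz functions. -/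
theorem continuousOn_initial (S : IsFundamentalSystem T δ η κ lam h w u v)
    (D : IsMarket T δ η κ lam) (H : ∀ c, IsTrajectory T δ η κ lam h ν₀ 0 c (p c) (P c) (q c))
    (X : ℝ) : ContinuousOn (fun c => q c 0) (Icc 0 X) := by
  obtain ⟨B, hB0, hB⟩ := IsTrajectory.exists_growth D S ν₀
  obtain ⟨C, hC, b⟩ := IsMarket.exists_bound (D.continuousOn_κ.mul S.sol_h.fst.continuousOn)
  set R := |residual ν₀ 0| + |residual ν₀ X| with hR
  have hres : ∀ c ∈ Icc 0 X, |residual ν₀ c| ≤ R := fun c hc => by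
    have e1 := antitone_residual ν₀ hc.1
    have e2 := antitone_residual ν₀ hc.2
    rw [abs_le]
    constructor
    · linarith [neg_abs_le (residual ν₀ X), abs_nonneg (residual ν₀ 0)]
    · linarith [le_abs_self (residual ν₀ 0), abs_nonneg (residual ν₀ X)]
  have hR0 : 0 ≤ R := by positivity
  refine continuousOn_of_uniform_approx_of_continuousOn fun U hU => ?_
  obtain ⟨ε, hε, hεU⟩ := Metric.mem_uniformity_dist.1 hU
  set K := C * (B * R) with hK
  have hK0 : 0 ≤ K := by positivity
  -- `K` bounds `|g'|`, so `|g a - g 0| ≤ K a < ε`.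
  set a := min T (ε / (K + 1)) / 2 with ha
  have hmin : 0 < min T (ε / (K + 1)) := lt_min D.T_pos (by positivity)
  have ha0 : 0 < a := half_pos hmin
  have haT : a ≤ T := (half_le_self hmin.le).trans (min_le_left _ _)
  have haε : a < ε / (K + 1) := (half_lt_self hmin).trans_le (min_le_right _ _)
  refine ⟨fun c => q c a, ?_, fun c hc => hεU ?_⟩
  · obtain ⟨C', hC'⟩ := IsTrajectory.exists_stability D S ν₀ ha0 haT
    have : LipschitzWith (Real.toNNReal C') fun c => q c a := by
      refine LipschitzWith.of_dist_le_mul fun c c' => ?_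
      have := hC' c c' _ _ _ _ _ _ ((H c).mono ha0.le haT) ((H c').mono ha0.le haT) a ⟨le_rfl, haT⟩
      rw [Real.dist_eq, Real.dist_eq]
      have n1 := abs_nonneg (P c a - P c' a)
      have n2 : C' * |c - c'| ≤ Real.toNNReal C' * |c - c'| := by
        gcongr; exact Real.le_coe_toNNReal C'
      linarith
    exact this.continuous.continuousOn
  · have h1 := (H c).deriv_g.integral_eq_sub le_rfl ha0.le haT
    rw [dist_comm, Real.dist_eq, ← h1]
    have h2 : ‖∫ x in (0 : ℝ)..a, κ x * h x * p c x‖ ≤ K * |a - 0| := by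
      refine intervalIntegral.norm_integral_le_of_norm_le_const fun x hx => ?_
      rw [uIoc_of_le ha0.le] at hx
      have hx' : x ∈ Icc 0 T := ⟨hx.1.le, hx.2.trans haT⟩
      have e1 : |κ x * h x| ≤ C := b x hx'
      have e2 := (hB 0 c _ _ _ le_rfl (H c) x hx').trans
        (mul_le_mul_of_nonneg_left (hres c hc) hB0)
      rw [Real.norm_eq_abs, abs_mul]
      exact mul_le_mul e1 e2 (abs_nonneg _) hC
    rw [sub_zero, abs_of_pos ha0, Real.norm_eq_abs] at h2
    rw [lt_div_iff₀ (by positivity)] at haε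
    nlinarith

theorem exists_root (S : IsFundamentalSystem T δ η κ lam h w u v)
    (D : IsMarket T δ η κ lam) (H : ∀ c, IsTrajectory T δ η κ lam h ν₀ 0 c (p c) (P c) (q c))
    (hE : 0 < residual ν₀ 0) : ∃ c, q c 0 = 0 := by
  obtain ⟨B, hB0, hB⟩ := IsTrajectory.exists_growth D S ν₀
  obtain ⟨C, hC, b⟩ := IsMarket.exists_bound (D.continuousOn_κ.mul S.sol_h.fst.continuousOn)
  have hT := D.T_pos
  -- `X` bounds `f_μ(T)` for every `c ≥ 0` with nonnegative residual, by growth and monotonicity of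
  -- `residual`; if the residual at `X` is negative, `f_μ(T) ≤ 0 ≤ X` anyway.
  set X := C * (B * residual ν₀ 0) * T with hX
  have hX0 : 0 ≤ X := by positivity
  have h0 : q 0 0 ≤ 0 := by
    rw [(H 0).g_zero S D]
    linarith [(H 0).fFun_nonneg S D hE.le]
  have h1 : 0 ≤ q X 0 := by
    rcases le_total (residual ν₀ X) 0 with hr | hr
    · rw [(H X).g_zero S D]
      linarith [(H X).fFun_nonpos S D hr]
    · rw [(H X).g_eq (left_mem_Icc.2 hT.le)]
      have h2 : ‖∫ x in (0 : ℝ)..T, κ x * h x * p X x‖ ≤ C * (B * residual ν₀ 0) * |T - 0| := by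
        refine intervalIntegral.norm_integral_le_of_norm_le_const fun x hx => ?_
        rw [uIoc_of_le hT.le] at hx
        have hx' : x ∈ Icc 0 T := ⟨hx.1.le, hx.2⟩
        have e1 : |κ x * h x| ≤ C := b x hx'
        have e2 := hB 0 X _ _ _ le_rfl (H X) x hx'
        rw [abs_of_nonneg hr] at e2
        have e3 := e2.trans (mul_le_mul_of_nonneg_left (antitone_residual ν₀ hX0) hB0)
        rw [Real.norm_eq_abs, abs_mul]
        exact mul_le_mul e1 e3 (abs_nonneg _) hC
      rw [sub_zero, abs_of_pos hT, ← hX] at h2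
      linarith [(le_abs_self _).trans h2]
  obtain ⟨c, -, hc⟩ := intermediate_value_Icc hX0 (continuousOn_initial S D H X)
    (show (0 : ℝ) ∈ Icc (q 0 0) (q X 0) from ⟨h0, h1⟩)
  exact ⟨c, hc⟩

/-- A nonpositive terminal value would force `c = f_μ(T) ≤ 0`, but there the residual is at least
its value at `0`, which is positive. This provides the sign hypothesis of the comparison principle
at every root. -/
theorem residual_pos_of_root (S : IsFundamentalSystem T δ η κ lam h w u v)
    (D : IsMarket T δ η κ lam) (H : IsTrajectory T δ η κ lam h ν₀ 0 c m M g)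
    (hE : 0 < residual ν₀ 0) (hc : g 0 = 0) : 0 < residual ν₀ c := by
  by_contra hr
  rw [not_lt] at hr
  have h1 := H.fFun_nonpos S D hr
  have h2 := H.g_zero S D
  have h3 : c ≤ 0 := by linarith
  linarith [antitone_residual ν₀ h3]

theorem root_unique (S : IsFundamentalSystem T δ η κ lam h w u v)
    (D : IsMarket T δ η κ lam) (H : ∀ c, IsTrajectory T δ η κ lam h ν₀ 0 c (p c) (P c) (q c))
    (hE : 0 < residual ν₀ 0) {x y : ℝ} (hx : q x 0 = 0) (hy : q y 0 = 0) : x = y := by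
  have key : ∀ x y, q x 0 = 0 → q y 0 = 0 → ¬ x < y := fun x y hx hy hxy => by
    have := (H x).sub_le_sub (H y) D S hxy (residual_pos_of_root S D (H x) hE hx).le
    linarith
  exact le_antisymm (not_lt.1 (key y x hy hx)) (not_lt.1 (key x y hx hy))

end FixedPoint

end LiquidationGame

open LiquidationGame in
theorem mainTheorem1 (T δ : ℝ) (hT : 0 < T) (hδ : δ ∈ Icc (0 : ℝ) 1)
    (η κ lam : ℝ → ℝ)
    (hη : ContDiffOn ℝ 1 η (Icc 0 T)) (hη_pos : ∀ t ∈ Icc 0 T, 0 < η t)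
    (hκ : ContDiffOn ℝ 1 κ (Icc 0 T)) (hκ_nonneg : ∀ t ∈ Icc 0 T, 0 ≤ κ t)
    (hlam : MemLp lam ⊤ (volume.restrict (Icc 0 T)))
    (hlam_nonneg : ∀ᵐ t ∂volume.restrict (Icc 0 T), 0 ≤ lam t)
    (hlamκ : ∀ᵐ t ∂volume.restrict (Icc 0 T), 0 ≤ lam t + δ * derivWithin κ (Icc 0 T) t)
    (ν₀ : Measure ℝ) [IsProbabilityMeasure ν₀] (hν₀ : Integrable (fun x : ℝ => x) ν₀) :
    -- the data of the equations are well defined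
    (IsRiccatiSolution T δ η κ lam (riccati T δ η κ lam) ∧
      (∀ A, IsRiccatiSolution T δ η κ lam A → EqOn A (riccati T δ η κ lam) (Ico 0 T)) ∧
      Tendsto (hFun T δ η κ lam) (𝓝[<] T) (𝓝 (alphaT T δ η κ lam)⁻¹) ∧
      0 < alphaT T δ η κ lam) ∧
    ∃ μ : ℝ → ℝ → ℝ,
      -- (i) for every `c`, `μ c` is the unique continuous solution of the backward equation
      (∀ c : ℝ, IsBackwardSolution T δ η κ lam ν₀ c (μ c) ∧
        ∀ m, IsBackwardSolution T δ η κ lam ν₀ c m → EqOn m (μ c) (Icc 0 T)) ∧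
      -- (ii)
      (0 < ∫ x, x ∂ν₀ →
        ∃ xhat : ℝ,
          fFun T δ η κ lam (μ xhat) T = xhat ∧
          (∀ y : ℝ, fFun T δ η κ lam (μ y) T = y → y = xhat) ∧
          IsEquilibriumSolution T δ η κ lam ν₀ (μ xhat) ∧
          (∀ m, IsEquilibriumSolution T δ η κ lam ν₀ m → EqOn m (μ xhat) (Icc 0 T)) ∧
          ((∃ t ∈ Icc 0 T, κ t ≠ 0) → 0 < xhat) ∧
          (xhat : EReal) < sSup ((fun x : ℝ => (x : EReal)) '' ν₀.support)) := by
  have D : IsMarket T δ η κ lam :=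
    ⟨hT, hδ, hη, hη_pos, hκ, hκ_nonneg, hlam, hlam_nonneg, hlamκ⟩
  obtain ⟨h, w, u, v, S⟩ := D.exists_fundamentalSystem
  have hα : (alphaT T δ η κ lam)⁻¹ = h T := by rw [S.alphaT_eq D, inv_inv]
  refine ⟨⟨S.isRiccatiSolution_riccati D, fun A hA => S.eqOn_riccati D hA, ?_, ?_⟩, ?_⟩
  · rw [hα]
    exact S.tendsto_hFun D
  · rw [S.alphaT_eq D]
    exact inv_pos.2 (S.h_pos T ⟨hT, le_rfl⟩)
  choose p P q H using S.exists_trajectory D ν₀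
  have huniq : ∀ c m, IsBackwardSolution T δ η κ lam ν₀ c m → EqOn m (p c) (Icc 0 T) :=
    fun c m hm => (S.isTrajectory_of_isBackwardSolution D hm).eqOn (H c) D S
  refine ⟨p, fun c => ⟨S.isBackwardSolution_of_isTrajectory D (H c), huniq c⟩, fun hE => ?_⟩
  rw [← residual_zero] at hE
  obtain ⟨x, hx⟩ := exists_root S D H hE
  have hroot : ∀ c, q c 0 = 0 ↔ fFun T δ η κ lam (p c) T = c := fun c => by
    rw [(H c).g_zero S D, sub_eq_zero, eq_comm]
  have hfx := (hroot x).1 hx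
  have hres := residual_pos_of_root S D (H x) hE hx
  refine ⟨x, hfx, fun y hy => root_unique S D H hE ((hroot y).2 hy) hx,
    S.isEquilibriumSolution_of_isBackwardSolution D (S.isBackwardSolution_of_isTrajectory D (H x))
      hfx, fun m hm => ?_, fun hκ0 => ?_, ?_⟩
  · have hb := S.isBackwardSolution_of_isEquilibriumSolution D hm
    have heq := huniq _ m hb
    -- Since `m` agrees with the solution for the parameter `f_m(T)`, that parameter is itself a
    -- fixed point, hence equals `x`.
    have hf : fFun T δ η κ lam (p (fFun T δ η κ lam m T)) T = fFun T δ η κ lam m T := by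
      refine intervalIntegral.integral_congr fun s hs => ?_
      rw [uIcc_of_le hT.le] at hs
      simp only [heq hs]
    rw [root_unique S D H hE ((hroot _).2 hf) hx] at heq
    exact heq
  · rw [← hfx]
    exact (H x).fFun_pos S D hres hκ0
  · refine lt_sSup_support ν₀ hν₀ ?_ hres
    rw [← hfx]
    exact (H x).fFun_nonneg S D hres.le
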